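/- Let the base stations be the points $X_1,X_2,\dots$ (numbered in an arbitrary order) of a homogeneous Poisson point process on $\mathbb R^2$ with intensity $\lambda\in(0,\infty)$. Let $\beta>2$ and $\sigma^2>0$, and let $H_{i,t}$ ($i\in\mathbb N$, $t\in\{0,1,2,\dots\}$) be mutually independent exponential random variables with mean $1$, independent of $(X_i)_i$. For a user at position $\boldsymbol u\in\mathbb R^2$ at time $t$ that is served by base station $i$, put $$\mathrm{SINR}_{\boldsymbol u,i,t}=\frac{H_{i,t}\,\|X_i-\boldsymbol u\|^{-\beta}}{\sigma^2+\sum_{j\ne i}H_{j,t}\,\|X_j-\boldsymbol u\|^{-\beta}}.$$ Fix an integer $s\ge 1$ and $l\ge 0$. A user moves at constant speed from the origin to $(l,0)$ in $s$ units of time, so that at time $t=0,\dots,s-1$ it is at $\boldsymbol u_t=(lt/s,0)$, and at each of these times it is served by its nearest base station $b_t$, that is, $\|X_{b_t}-\boldsymbol u_t\|\le\|X_j-\boldsymbol u_t\|$ for all $j$ (the non-skipping scenario). Almost surely such an index $b_t$ exists and is unique. The data rates $\log(1+\mathrm{SINR}_{\boldsymbol u_t,b_t,t})$ have finite expectation,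 and the expected amount of data received in the movement period, $$D_1(s,l,\lambda,\beta)=\mathsf E\Bigl[\sum_{t=0}^{s-1}\log\bigl(1+\mathrm{SINR}_{\boldsymbol u_t,b_t,t}\bigr)\Bigr],$$ is given by $$D_1(s,l,\lambda,\beta)=s\,\tau_1(\lambda,\beta),\qquad \tau_1(\lambda,\beta)=\int_0^\infty\!\!\int_0^\infty\frac{\rho_1(z,u,\lambda,\beta)}{1+z}\,\mathrm dz\,\mathrm du,$$ where the double integral converges and $$\rho_1(z,u,\lambda,\beta)=\exp\biggl\{-\sigma^2 z\Bigl(\frac{u}{\pi\lambda}\Bigr)^{\beta/2}-u\biggl(1+\frac{2z^{2/\beta}}{\beta}\int_{1/z}^\infty\frac{v^{2/\beta-1}}{1+v}\,\mathrm dv\biggr)\biggr\}.$$ In particular $D_1(s,l,\lambda,\beta)$ does not depend on $l$. -/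

import Mathlib

open MeasureTheory ProbabilityTheory Set
open scoped NNReal ENNReal

noncomputable section

namespace HandoverSkipping

/-- The Euclidean plane. -/
abbrev Plane : Type := EuclideanSpace ℝ (Fin 2)

variable {Ω : Type*} [MeasurableSpace Ω]

/-- The random counting measure `Φ = ∑ i, δ_{X i}` of a sequence of random points. -/
def pointMeasure (X : ℕ → Ω → Plane) (ω : Ω) : Measure Plane :=
  Measure.sum fun i => Measure.dirac (X i ω)

/-- The points `X 0, X 1, …` enumerate a homogeneous Poisson point process on the plane with
intensity `lam`: the number of points in a Borel set `B` of finite area is Poisson distributed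
with mean `lam * area B`, and the numbers of points in pairwise disjoint Borel sets are
independent. -/
structure IsHomogeneousPPP (μ : Measure Ω) (lam : ℝ) (X : ℕ → Ω → Plane) : Prop where
  measurable : ∀ i, Measurable (X i)
  count_law : ∀ B : Set Plane, MeasurableSet B → volume B ≠ ∞ →
    HasLaw (fun ω => pointMeasure X ω B)
      ((poissonMeasure (lam * (volume B).toReal).toNNReal).map (Nat.cast : ℕ → ℝ≥0∞)) μ
  count_indep : ∀ (n : ℕ) (B : Fin n → Set Plane), (∀ k, MeasurableSet (B k)) →
    Pairwise (fun k m => Disjoint (B k) (B m)) →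
    iIndepFun (fun k ω => pointMeasure X ω (B k)) μ

/-- The network model: base stations `X i` forming a homogeneous Poisson point process, and
unit-mean exponential (Rayleigh) fading variables `H i t`, for base station `i` at time `t`, that
are mutually independent and independent of the base stations. -/
structure IsCellularNetwork (μ : Measure Ω) (lam : ℝ) (X : ℕ → Ω → Plane)
    (H : ℕ → ℕ → Ω → ℝ) : Prop where
  ppp : IsHomogeneousPPP μ lam X
  fading_measurable : ∀ i t, Measurable (H i t)
  fading_law : ∀ i t, HasLaw (H i t) (expMeasure 1) μ
  fading_indep : iIndepFun (fun p : ℕ × ℕ => H p.1 p.2) μ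
  fading_indep_ppp : IndepFun (fun ω i => X i ω) (fun ω (p : ℕ × ℕ) => H p.1 p.2 ω) μ

/-- Power received at position `u` and time `t` from base station `i`. -/
def receivedPower (β : ℝ) (X : ℕ → Ω → Plane) (H : ℕ → ℕ → Ω → ℝ)
    (u : Plane) (i t : ℕ) (ω : Ω) : ℝ :=
  H i t ω * ‖X i ω - u‖ ^ (-β)

/-- Interference power at position `u` and time `t` for a user served by base station `i`: the
sum of a series of nonnegative terms, with values in `[0, ∞]`. -/
def interference (β : ℝ) (X : ℕ → Ω → Plane) (H : ℕ → ℕ → Ω → ℝ)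
    (u : Plane) (i t : ℕ) (ω : Ω) : ℝ≥0∞ :=
  ∑' j : {j : ℕ // j ≠ i}, ENNReal.ofReal (receivedPower β X H u j t ω)

/-- Signal-to-interference-plus-noise ratio, with noise power `σ ^ 2`. -/
def SINR (σ β : ℝ) (X : ℕ → Ω → Plane) (H : ℕ → ℕ → Ω → ℝ)
    (u : Plane) (i t : ℕ) (ω : Ω) : ℝ≥0∞ :=
  ENNReal.ofReal (receivedPower β X H u i t ω) /
    (ENNReal.ofReal (σ ^ 2) + interference β X H u i t ω)

/-- Data received in the time unit `t` at position `u` from base station `i`. The SINR is finite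
when `σ ≠ 0`. -/
def dataRate (σ β : ℝ) (X : ℕ → Ω → Plane) (H : ℕ → ℕ → Ω → ℝ)
    (u : Plane) (i t : ℕ) (ω : Ω) : ℝ :=
  Real.log (1 + (SINR σ β X H u i t ω).toReal)

/-- `i` is the index of a base station nearest to the position `u`. -/
def IsNearest (X : ℕ → Ω → Plane) (u : Plane) (ω : Ω) (i : ℕ) : Prop :=
  ∀ j, ‖X i ω - u‖ ≤ ‖X j ω - u‖

/-- The index of the base station nearest to `u` (the least such index in case of ties). -/
def nearestBS (X : ℕ → Ω → Plane) (u : Plane) (ω : Ω) : ℕ :=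
  sInf {i | IsNearest X u ω i}

/-- Position at time `t` of a user that moves from the origin to `(l, 0)` at constant speed in
`s` units of time. -/
def position (s : ℕ) (l : ℝ) (t : ℕ) : Plane :=
  !₂[l * t / s, 0]

/-- Data received in the time unit `t` of the movement period in the non-skipping scenario: the
user is served by the base station nearest to its current position. -/
def nonSkippingRate (σ β : ℝ) (X : ℕ → Ω → Plane) (H : ℕ → ℕ → Ω → ℝ)
    (s : ℕ) (l : ℝ) (t : ℕ) (ω : Ω) : ℝ :=
  dataRate σ β X H (position s l t) (nearestBS X (position s l t) ω) t ω

/-- Expected amount of data received in a movement period (the times `0, …, s - 1`) in the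
non-skipping scenario. -/
def D1 (μ : Measure Ω) (σ β : ℝ) (X : ℕ → Ω → Plane) (H : ℕ → ℕ → Ω → ℝ)
    (s : ℕ) (l : ℝ) : ℝ :=
  ∫ ω, ∑ t ∈ Finset.range s, nonSkippingRate σ β X H s l t ω ∂μ

/-- The function `ρ₁(z, u, lam, β)`. -/
def rho1 (σ lam β z u : ℝ) : ℝ :=
  Real.exp (-σ ^ 2 * z * (u / (Real.pi * lam)) ^ (β / 2) -
    u * (1 + 2 * z ^ (2 / β) / β * ∫ v in Ioi (1 / z), v ^ (2 / β - 1) / (1 + v)))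

/-- The function `τ₁(lam, β)`. -/
def tau1 (σ lam β : ℝ) : ℝ :=
  ∫ u in Ioi (0 : ℝ), ∫ z in Ioi (0 : ℝ), rho1 σ lam β z u / (1 + z)

end HandoverSkipping

end

noncomputable section

namespace HandoverSkipping

open Filter Topology

/-! For a fixed position `u`, the map `x ↦ lam * π * ‖x - u‖ ^ 2` sends the base stations to a unit
rate Poisson process on the half-line (`map_scaledArea_volume`). Its law does not involve `u`, so
each time step contributes the same expectation and `l` disappears.

Given the positions, `SINR ≥ z` says that the exponential fading of the serving station exceeds
noise plus interference, suitably scaled. The exponential tail turns this probability into a Laplace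
transform, and independence of the fading factorises it (`measure_le_fading`). What remains is a
functional of the first point `m` of the unit rate process and of the points beyond it.

The first point is exponential, and given `m = u` the rest is a Poisson process on `(u, ∞)`
(`IsPoissonPP.lintegral_first`). The Laplace functional of that process, after a change of variables
(`setIntegral_pathloss`), produces `rho1`, so that `P(SINR ≥ z) = ∫ rho1 σ lam β z v dv`. Finally
`log (1 + y) = ∫₀^y dz / (1 + z)` and Tonelli give `tau1`; its finiteness comes from the noise term
(`rho1_le`).

Random sums are kept in `[0, ∞]` and only pass through the bounded continuous function `expNeg`, so
no convergence of the interference has to be proved. -/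

/-! ### The negative exponential on `[0, ∞]`. -/

/-- The function `x ↦ e ^ (-x)` on `[0, ∞]`, with `e ^ (-∞) = 0`. -/
def expNeg (x : ℝ≥0∞) : ℝ≥0∞ := EReal.exp (-(x : EReal))

lemma expNeg_zero : expNeg 0 = 1 := by simp [expNeg]

lemma expNeg_top : expNeg ∞ = 0 := by simp [expNeg]

lemma expNeg_ofReal {r : ℝ} (hr : 0 ≤ r) :
    expNeg (ENNReal.ofReal r) = ENNReal.ofReal (Real.exp (-r)) := by
  rw [expNeg, EReal.coe_ennreal_ofReal, max_eq_left hr, ← EReal.coe_neg, EReal.exp_coe]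

lemma expNeg_add (x y : ℝ≥0∞) : expNeg (x + y) = expNeg x * expNeg y := by
  rw [expNeg, expNeg, expNeg, ← EReal.exp_add, EReal.coe_ennreal_add, EReal.neg_add, sub_eq_add_neg]
  · left; simp
  · right; simp

lemma expNeg_antitone : Antitone expNeg := fun _ _ h =>
  EReal.exp_monotone (EReal.neg_le_neg_iff.2 (EReal.coe_ennreal_le_coe_ennreal_iff.2 h))

lemma expNeg_le_one (x : ℝ≥0∞) : expNeg x ≤ 1 := by
  rw [← expNeg_zero]; exact expNeg_antitone zero_le

lemma continuous_expNeg : Continuous expNeg :=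
  ENNReal.continuous_exp.comp (continuous_neg.comp continuous_coe_ennreal_ereal)

@[fun_prop]
lemma measurable_expNeg : Measurable expNeg := continuous_expNeg.measurable

lemma expNeg_sum {ι : Type*} (s : Finset ι) (f : ι → ℝ≥0∞) :
    expNeg (∑ i ∈ s, f i) = ∏ i ∈ s, expNeg (f i) := by
  classical
  induction s using Finset.induction_on with
  | empty => simp [expNeg_zero]
  | insert a s ha ih => rw [Finset.sum_insert ha, Finset.prod_insert ha, expNeg_add, ih]

/-! ### Poisson processes with a general intensity measure. -/

/-- The points `Y 0, Y 1, …` enumerate a Poisson point process with intensity measure `ν`. -/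
structure IsPoissonPP {Ω E : Type*} [MeasurableSpace Ω] [MeasurableSpace E] (μ : Measure Ω)
    (ν : Measure E) (Y : ℕ → Ω → E) : Prop where
  measurable : ∀ i, Measurable (Y i)
  count_law : ∀ B : Set E, MeasurableSet B → ν B ≠ ∞ →
    HasLaw (fun ω => Measure.sum (fun i => Measure.dirac (Y i ω)) B)
      ((poissonMeasure (ν B).toNNReal).map (Nat.cast : ℕ → ℝ≥0∞)) μ
  count_indep : ∀ (n : ℕ) (B : Fin n → Set E), (∀ k, MeasurableSet (B k)) →
    Pairwise (fun k m => Disjoint (B k) (B m)) →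
    iIndepFun (fun k ω => Measure.sum (fun i => Measure.dirac (Y i ω)) (B k)) μ

lemma IsHomogeneousPPP.isPoissonPP {Ω : Type*} [MeasurableSpace Ω] {μ : Measure Ω} {lam : ℝ}
    (hlam : 0 < lam) {X : ℕ → Ω → Plane} (h : IsHomogeneousPPP μ lam X) :
    IsPoissonPP μ (ENNReal.ofReal lam • (volume : Measure Plane)) X where
  measurable := h.measurable
  count_indep := h.count_indep
  count_law B hB hfin := by
    have hB' : volume B ≠ ∞ := by
      intro h'
      apply hfin
      simp [h', ENNReal.mul_top, hlam]
    convert! h.count_law B hB hB' using 4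
    simp only [Measure.smul_apply, smul_eq_mul, ENNReal.toNNReal_mul]
    rw [Real.toNNReal_mul hlam.le, ENNReal.ofReal, ENNReal.toNNReal_coe, ENNReal.toReal,
      Real.toNNReal_coe]

/-- The mapping theorem for Poisson processes. -/
lemma IsPoissonPP.map {Ω E F : Type*} [MeasurableSpace Ω] [MeasurableSpace E]
    [MeasurableSpace F] {μ : Measure Ω} {ν : Measure E} {Y : ℕ → Ω → E}
    (h : IsPoissonPP μ ν Y) {f : E → F} (hf : Measurable f) :
    IsPoissonPP μ (ν.map f) (fun i ω => f (Y i ω)) := by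
  have key : ∀ (B : Set F), MeasurableSet B → ∀ ω,
      Measure.sum (fun i => Measure.dirac (f (Y i ω))) B =
        Measure.sum (fun i => Measure.dirac (Y i ω)) (f ⁻¹' B) := by
    intro B hB ω
    rw [Measure.sum_apply _ hB, Measure.sum_apply _ (hf hB)]
    refine tsum_congr fun i => ?_
    rw [Measure.dirac_apply' _ hB, Measure.dirac_apply' _ (hf hB)]
    rfl
  refine ⟨fun i => hf.comp (h.measurable i), fun B hB hfin => ?_, fun n B hB hd => ?_⟩
  · simp_rw [key B hB]
    rw [Measure.map_apply hf hB] at hfin ⊢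
    exact h.count_law _ (hf hB) hfin
  · simp_rw [key _ (hB _)]
    exact h.count_indep n (fun k => f ⁻¹' B k) (fun k => hf (hB k)) fun k m hkm =>
      (hd hkm).preimage f

/-- The Laplace transform of the Poisson distribution. -/
lemma lintegral_expNeg_poissonMeasure (r c : ℝ≥0) :
    ∫⁻ n : ℕ, expNeg (c * n) ∂(poissonMeasure r) = expNeg ((1 - expNeg c) * r) := by
  have hc : expNeg c = ENNReal.ofReal (Real.exp (-c)) := by
    rw [← ENNReal.ofReal_coe_nnreal, expNeg_ofReal c.coe_nonneg]
  have hle : Real.exp (-(c : ℝ)) ≤ 1 := Real.exp_le_one_iff.2 (by simp)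
  rw [poissonMeasure, lintegral_sum_measure]
  simp only [lintegral_smul_measure, lintegral_dirac, smul_eq_mul]
  have h1 : ∀ n : ℕ, ENNReal.ofReal (Real.exp (-(r : ℝ)) * (r : ℝ) ^ n / (n.factorial : ℝ)) *
      expNeg (c * n) = ENNReal.ofReal
        (Real.exp (-(r : ℝ)) * ((r * Real.exp (-(c : ℝ))) ^ n / n.factorial)) := by
    intro n
    have : (c : ℝ≥0∞) * n = ENNReal.ofReal (c * n) := by
      rw [ENNReal.ofReal_mul c.coe_nonneg]; simp
    rw [this, expNeg_ofReal (by positivity), ← ENNReal.ofReal_mul (by positivity), mul_pow,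
      ← Real.exp_nat_mul]
    congr 1
    rw [show (n : ℝ) * -(c : ℝ) = -(c * n) by ring]
    ring
  have hs := (NormedSpace.expSeries_div_hasSum_exp ((r : ℝ) * Real.exp (-(c : ℝ)))).mul_left
    (Real.exp (-(r : ℝ)))
  rw [← Real.exp_eq_exp_ℝ, ← Real.exp_add] at hs
  simp_rw [h1]
  rw [← ENNReal.ofReal_tsum_of_nonneg (fun n => by positivity) hs.summable, hs.tsum_eq, hc,
    ← ENNReal.ofReal_one, ← ENNReal.ofReal_sub _ (by positivity), ← ENNReal.ofReal_coe_nnreal,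
    ← ENNReal.ofReal_mul (by linarith), expNeg_ofReal (mul_nonneg (by linarith) r.coe_nonneg)]
  congr 2
  ring

/-! ### The Laplace functional of a Poisson process. -/

section Laplace

variable {Ω E : Type*} [MeasurableSpace Ω] [MeasurableSpace E] {μ : Measure Ω} {ν : Measure E}
  {Y : ℕ → Ω → E}

omit [MeasurableSpace Ω] in
lemma lintegral_sum_dirac (Y : ℕ → Ω → E) {φ : E → ℝ≥0∞} (hφ : Measurable φ) (ω : Ω) :
    ∫⁻ x, φ x ∂(Measure.sum fun i => Measure.dirac (Y i ω)) = ∑' i, φ (Y i ω) := by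
  rw [lintegral_sum_measure]
  exact tsum_congr fun i => lintegral_dirac' _ hφ

lemma IsPoissonPP.measurable_count (h : IsPoissonPP μ ν Y) {B : Set E}
    (hB : MeasurableSet B) :
    Measurable fun ω => Measure.sum (fun i => Measure.dirac (Y i ω)) B := by
  have : (fun ω => Measure.sum (fun i => Measure.dirac (Y i ω)) B) =
      fun ω => ∑' i, B.indicator 1 (Y i ω) := by
    ext ω
    rw [Measure.sum_apply _ hB]
    exact tsum_congr fun i => Measure.dirac_apply' _ hB
  rw [this]
  exact Measurable.tsum fun i => (measurable_one.indicator hB).comp (h.measurable i)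

lemma IsPoissonPP.lintegral_expNeg_count (h : IsPoissonPP μ ν Y) {B : Set E}
    (hB : MeasurableSet B) (hfin : ν B ≠ ∞) (c : ℝ≥0) :
    ∫⁻ ω, expNeg (c * Measure.sum (fun i => Measure.dirac (Y i ω)) B) ∂μ =
      expNeg ((1 - expNeg c) * ν B) := by
  have hm : Measurable fun x : ℝ≥0∞ => expNeg (c * x) := by fun_prop
  have := (h.count_law B hB hfin).lintegral_comp (f := fun x : ℝ≥0∞ => expNeg (c * x))
    hm.aemeasurable
  rw [this, lintegral_map hm .of_discrete, lintegral_expNeg_poissonMeasure,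
    ENNReal.coe_toNNReal hfin]

/-- The sum is a combination of the counts of the disjoint sets `s ⁻¹' {c} ∩ S`, which are
independent Poisson variables, so its Laplace transform is a finite product. The set `S` keeps every
fibre, including that of `0`, of finite mass. -/
lemma IsPoissonPP.lintegral_expNeg_simpleFunc (h : IsPoissonPP μ ν Y)
    (s : SimpleFunc E ℝ≥0∞) (hs : ∀ x, s x ≠ ∞) {S : Set E} (hS : MeasurableSet S)
    (hSfin : ν S ≠ ∞) :
    ∫⁻ ω, expNeg (∑' i, S.indicator s (Y i ω)) ∂μ =
      expNeg (∫⁻ x, (1 - expNeg (S.indicator s x)) ∂ν) := by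
  classical
  -- Used twice: for `ν` with `g = 1 - expNeg`, and for the random counting measure with `g = id`.
  have hsum : ∀ (κ : Measure E) (g : ℝ≥0∞ → ℝ≥0∞), g 0 = 0 →
      ∫⁻ x, g (S.indicator s x) ∂κ = ∑ c ∈ s.range, g c * κ (s ⁻¹' {c} ∩ S) := by
    intro κ g hg
    have : ∀ x, g (S.indicator s x) = S.indicator (s.map g) x := by
      intro x
      by_cases hx : x ∈ S <;> simp [hx, hg]
    simp_rw [this]
    rw [lintegral_indicator hS, SimpleFunc.lintegral_eq_lintegral, SimpleFunc.map_lintegral]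
    refine Finset.sum_congr rfl fun c _ => ?_
    rw [Measure.restrict_apply (s.measurableSet_fiber c)]
  have hmeas : Measurable (S.indicator s) := s.measurable.indicator hS
  have hfinB : ∀ c, ν (s ⁻¹' {c} ∩ S) ≠ ∞ := fun c =>
    ne_top_of_le_ne_top hSfin (measure_mono inter_subset_right)
  rw [hsum ν (fun x => 1 - expNeg x) (by simp [expNeg_zero]), expNeg_sum]
  simp_rw [← lintegral_sum_dirac Y hmeas, hsum _ (fun x => x) rfl, expNeg_sum]
  set e := s.range.equivFin
  have hind := h.count_indep s.range.card
    (fun k => s ⁻¹' {((e.symm k : s.range) : ℝ≥0∞)} ∩ S)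
    (fun k => (s.measurableSet_fiber _).inter hS) (by
      intro k m hkm
      refine Disjoint.mono inter_subset_left inter_subset_left ?_
      refine Disjoint.preimage _ ?_
      rw [disjoint_singleton]
      intro h'
      exact hkm (e.symm.injective (Subtype.ext h')))
  have hind2 := hind.comp (fun k x => expNeg (((e.symm k : s.range) : ℝ≥0∞) * x))
    (fun k => by fun_prop)
  have hmain := lintegral_prod_eq_prod_lintegral_of_indepFun Finset.univ _ hind2 (fun k =>
    Measurable.comp (by fun_prop)
      (h.measurable_count ((s.measurableSet_fiber _).inter hS)))
  have conv : ∀ F : ℝ≥0∞ → ℝ≥0∞, ∏ c ∈ s.range, F c =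
      ∏ k : Fin s.range.card, F ((e.symm k : s.range) : ℝ≥0∞) := by
    intro F
    rw [← Finset.prod_coe_sort s.range F]
    exact (Equiv.prod_comp e.symm fun c : s.range => F c).symm
  simp_rw [conv]
  refine hmain.trans (Finset.prod_congr rfl fun k _ => ?_)
  obtain ⟨x, hx⟩ := SimpleFunc.mem_range.1 (e.symm k).2
  have hc : ((e.symm k : s.range) : ℝ≥0∞) ≠ ∞ := by rw [← hx]; exact hs x
  have := h.lintegral_expNeg_count ((s.measurableSet_fiber
    ((e.symm k : s.range) : ℝ≥0∞)).inter hS) (hfinB _) (((e.symm k : s.range) : ℝ≥0∞).toNNReal)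
  rw [ENNReal.coe_toNNReal hc] at this
  exact this

/-- The Laplace functional of a Poisson process. -/
theorem IsPoissonPP.lintegral_expNeg [IsProbabilityMeasure μ] [SigmaFinite ν]
    (h : IsPoissonPP μ ν Y) {φ : E → ℝ≥0∞} (hφ : Measurable φ) :
    ∫⁻ ω, expNeg (∑' i, φ (Y i ω)) ∂μ = expNeg (∫⁻ x, (1 - expNeg (φ x)) ∂ν) := by
  -- Truncation in both value and support brings `φ` within reach of the simple function case.
  set ψ : ℕ → E → ℝ≥0∞ := fun n => (spanningSets ν n).indicator (SimpleFunc.eapprox φ n) with hψ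
  have hψm : ∀ n, Measurable (ψ n) := fun n =>
    (SimpleFunc.measurable _).indicator (measurableSet_spanningSets ν n)
  have hmono : Monotone ψ := by
    intro m n hmn x
    refine indicator_le_indicator_of_subset (monotone_spanningSets ν hmn) (fun _ => zero_le) x
      |>.trans ?_
    exact indicator_le_indicator (SimpleFunc.monotone_eapprox φ hmn x)
  have hlim : ∀ x, Tendsto (fun n => ψ n x) atTop (𝓝 (φ x)) := by
    intro x
    have h1 : Tendsto (fun n => SimpleFunc.eapprox φ n x) atTop (𝓝 (φ x)) :=
      SimpleFunc.tendsto_eapprox hφ x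
    refine h1.congr' ?_
    have hx : x ∈ ⋃ n, spanningSets ν n := by rw [iUnion_spanningSets]; trivial
    obtain ⟨N, hN⟩ := mem_iUnion.1 hx
    filter_upwards [eventually_ge_atTop N] with n hn
    exact (indicator_of_mem (monotone_spanningSets ν hn hN) _).symm
  have hL : Tendsto (fun n => ∫⁻ ω, expNeg (∑' i, ψ n (Y i ω)) ∂μ) atTop
      (𝓝 (∫⁻ ω, expNeg (∑' i, φ (Y i ω)) ∂μ)) := by
    refine tendsto_lintegral_of_dominated_convergence (fun _ => 1) (fun n => ?_)
      (fun n => ae_of_all _ fun ω => expNeg_le_one _) (by simp) (ae_of_all _ fun ω => ?_)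
    · exact measurable_expNeg.comp
        (Measurable.tsum fun i => (hψm n).comp (h.measurable i))
    · refine (continuous_expNeg.tendsto _).comp ?_
      simp_rw [← lintegral_sum_dirac Y (hψm _), ← lintegral_sum_dirac Y hφ]
      exact lintegral_tendsto_of_tendsto_of_monotone (fun n => (hψm n).aemeasurable)
        (ae_of_all _ fun x m n hmn => hmono hmn x) (ae_of_all _ hlim)
  have hR : Tendsto (fun n => expNeg (∫⁻ x, (1 - expNeg (ψ n x)) ∂ν)) atTop
      (𝓝 (expNeg (∫⁻ x, (1 - expNeg (φ x)) ∂ν))) := by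
    refine (continuous_expNeg.tendsto _).comp ?_
    refine lintegral_tendsto_of_tendsto_of_monotone
      (fun n => (measurable_const.sub (measurable_expNeg.comp (hψm n))).aemeasurable)
      (ae_of_all _ fun x m n hmn => tsub_le_tsub_left (expNeg_antitone (hmono hmn x)) _)
      (ae_of_all _ fun x => ?_)
    exact ENNReal.Tendsto.sub tendsto_const_nhds ((continuous_expNeg.tendsto _).comp (hlim x))
      (Or.inl (by simp))
  refine tendsto_nhds_unique hL (hR.congr fun n => ?_)
  exact (h.lintegral_expNeg_simpleFunc _ (fun x => (SimpleFunc.eapprox_lt_top φ n x).ne)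
    (measurableSet_spanningSets ν n) (measure_spanningSets_lt_top ν n).ne).symm

end Laplace

/-! ### Reduction to the unit rate process on the half-line. -/

/-- The area of the disc around `u` that reaches up to `x`, scaled by `lam`. In this coordinate
the distances from `u` of a Poisson process of intensity `lam` form a unit rate Poisson process. -/
def scaledArea (lam : ℝ) (u x : Plane) : ℝ := lam * Real.pi * ‖x - u‖ ^ 2

@[fun_prop]
lemma measurable_scaledArea (lam : ℝ) (u : Plane) : Measurable (scaledArea lam u) := by
  unfold scaledArea; fun_prop

/-- The preimage of `Iio b` is a disc of area `b / lam` for `b ≥ 0` and empty for `b ≤ 0`.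
Differences of such sets give the mass of every `Ico a b`, and these determine the measure. -/
lemma map_scaledArea_volume {lam : ℝ} (hlam : 0 < lam) (u : Plane) :
    (ENNReal.ofReal lam • (volume : Measure Plane)).map (scaledArea lam u) =
      (volume : Measure ℝ).restrict (Ici 0) := by
  have hpos : 0 < lam * Real.pi := by positivity
  have hball : ∀ b : ℝ, scaledArea lam u ⁻¹' Iio b =
      Metric.ball u (Real.sqrt (b / (lam * Real.pi))) := by
    intro b
    ext x
    rw [mem_preimage, mem_Iio, scaledArea, Metric.mem_ball, dist_eq_norm,
      Real.lt_sqrt (norm_nonneg _), lt_div_iff₀ hpos, mul_comm]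
  have hmass : ∀ b : ℝ,
      (ENNReal.ofReal lam • (volume : Measure Plane)) (scaledArea lam u ⁻¹' Iio b) =
        ENNReal.ofReal b := by
    intro b
    rw [hball, Measure.smul_apply, EuclideanSpace.volume_ball_fin_two, smul_eq_mul,
      ← ENNReal.ofReal_pow (Real.sqrt_nonneg _), ← ENNReal.ofReal_mul (by positivity),
      ← ENNReal.ofReal_mul hlam.le]
    rcases le_total 0 b with hb | hb
    · rw [Real.sq_sqrt (by positivity)]
      congr 1
      field_simp
    · rw [Real.sqrt_eq_zero_of_nonpos (div_nonpos_of_nonpos_of_nonneg hb hpos.le),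
        ENNReal.ofReal_of_nonpos hb]
      simp
  symm
  refine Measure.ext_of_Ico _ _ fun a b hab => ?_
  have hIco : Ico a b = Iio b \ Iio a := by ext; simp
  have hIci : Ici 0 ∩ Ico a b = Ico (0 ⊔ a) b := by ext; simp [and_assoc]
  rw [Measure.map_apply (by fun_prop) measurableSet_Ico, hIco, preimage_sdiff,
    measure_sdiff (preimage_mono (Iio_subset_Iio hab.le))
      (measurable_scaledArea lam u measurableSet_Iio).nullMeasurableSet (by rw [hmass]; simp),
    hmass, hmass, ← hIco, Measure.restrict_apply measurableSet_Ico, inter_comm,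
    hIci, Real.volume_Ico]
  rcases le_total 0 a with ha | ha
  · rw [sup_eq_right.2 ha, ENNReal.ofReal_sub _ ha]
  · rw [sup_eq_left.2 ha, ENNReal.ofReal_of_nonpos ha]
    simp

lemma IsHomogeneousPPP.isPoissonPP_scaledArea {Ω : Type*} [MeasurableSpace Ω]
    {μ : Measure Ω} {lam : ℝ} (hlam : 0 < lam) {X : ℕ → Ω → Plane}
    (h : IsHomogeneousPPP μ lam X) (u : Plane) :
    IsPoissonPP μ (volume.restrict (Ici (0 : ℝ))) fun i ω => scaledArea lam u (X i ω) := by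
  have := (h.isPoissonPP hlam).map (measurable_scaledArea lam u)
  rwa [map_scaledArea_volume hlam] at this

/-! ### Almost sure properties and tail bounds of the counts. -/

section Counts

variable {Ω E : Type*} [MeasurableSpace Ω] [MeasurableSpace E] {μ : Measure Ω} {ν : Measure E}
  {Y : ℕ → Ω → E}

lemma IsPoissonPP.ae_count_ne_top (h : IsPoissonPP μ ν Y) {B : Set E}
    (hB : MeasurableSet B) (hfin : ν B ≠ ∞) :
    ∀ᵐ ω ∂μ, Measure.sum (fun i => Measure.dirac (Y i ω)) B ≠ ∞ := by
  have hm : MeasurableSet {x : ℝ≥0∞ | x ≠ ∞} := (measurableSet_singleton _).compl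
  refine ae_of_ae_map (p := fun x => x ≠ ∞) (h.measurable_count hB).aemeasurable ?_
  rw [(h.count_law B hB hfin).map_eq, ae_map_iff .of_discrete hm]
  exact ae_of_all _ fun n => ENNReal.natCast_ne_top n

lemma IsPoissonPP.ae_finite (h : IsPoissonPP μ ν Y) {B : Set E}
    (hB : MeasurableSet B) (hfin : ν B ≠ ∞) : ∀ᵐ ω ∂μ, {i | Y i ω ∈ B}.Finite := by
  filter_upwards [h.ae_count_ne_top hB hfin] with ω hω
  rw [Measure.sum_apply _ hB] at hω
  refine (ENNReal.finite_const_le_of_tsum_ne_top hω one_ne_zero).subset fun i hi => ?_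
  rw [mem_ofPred_eq, Measure.dirac_apply' _ hB, indicator_of_mem (mem_ofPred_eq ▸ hi)]
  rfl

lemma IsPoissonPP.ae_forall_notMem (h : IsPoissonPP μ ν Y) {B : Set E}
    (hB : MeasurableSet B) (hnull : ν B = 0) : ∀ᵐ ω ∂μ, ∀ i, Y i ω ∉ B := by
  have hm : MeasurableSet {x : ℝ≥0∞ | x = 0} := measurableSet_singleton _
  have h0 : ∀ᵐ ω ∂μ, Measure.sum (fun i => Measure.dirac (Y i ω)) B = 0 := by
    refine ae_of_ae_map (p := fun x => x = 0) (h.measurable_count hB).aemeasurable ?_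
    rw [(h.count_law B hB (by simp [hnull])).map_eq, ae_map_iff .of_discrete hm, hnull]
    rw [poissonMeasure, ENNReal.toNNReal_zero, ae_iff, Measure.sum_apply _ .of_discrete]
    refine ENNReal.tsum_eq_zero.2 fun n => ?_
    rcases Nat.eq_zero_or_pos n with rfl | hn
    · simp
    · simp [hn.ne']
  filter_upwards [h0] with ω hω i hi
  rw [Measure.sum_apply _ hB, ENNReal.tsum_eq_zero] at hω
  have := hω i
  rw [Measure.dirac_apply' _ hB, indicator_of_mem hi] at this
  exact one_ne_zero this

/-- With `r` the mean, `1 - exp (-r) * (1 + r) ≤ r ^ 2` follows from `exp (-r) ≥ 1 - r`. The order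
`r ^ 2` is what excludes multiple points: it still tends to zero when summed over about `1 / r`
cells. -/
lemma IsPoissonPP.measure_two_le_count (h : IsPoissonPP μ ν Y) {B : Set E}
    (hB : MeasurableSet B) (hfin : ν B ≠ ∞) :
    μ {ω | 2 ≤ Measure.sum (fun i => Measure.dirac (Y i ω)) B} ≤ ν B ^ 2 := by
  set r := (ν B).toNNReal with hr
  rw [(h.count_law B hB hfin).measure_eq (p := fun x => 2 ≤ x) measurableSet_Ici,
    Measure.map_apply .of_discrete (show MeasurableSet {x : ℝ≥0∞ | 2 ≤ x} from measurableSet_Ici),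
    ← hr]
  have hset : (Nat.cast : ℕ → ℝ≥0∞) ⁻¹' {x | 2 ≤ x} = ({0, 1} : Set ℕ)ᶜ := by
    ext n
    simp only [mem_preimage, mem_ofPred_eq, mem_compl_iff, mem_insert_iff, mem_singleton_iff]
    rw [show (2 : ℝ≥0∞) = ((2 : ℕ) : ℝ≥0∞) by norm_num, Nat.cast_le]
    omega
  rw [hset, prob_compl_eq_one_sub .of_discrete, show ({0, 1} : Set ℕ) = {0} ∪ {1} from rfl,
    measure_union (by simp) .of_discrete, poissonMeasure_singleton, poissonMeasure_singleton]
  rw [← ENNReal.coe_toNNReal hfin, ← hr, ← ENNReal.ofReal_add (by positivity) (by positivity),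
    ← ENNReal.ofReal_one, ← ENNReal.ofReal_sub _ (by positivity), ← ENNReal.ofReal_coe_nnreal,
    ← ENNReal.ofReal_pow r.coe_nonneg]
  refine ENNReal.ofReal_le_ofReal ?_
  have h1 : 1 - (r : ℝ) ≤ Real.exp (-r) := by linarith [Real.add_one_le_exp (-(r : ℝ))]
  have h2 : (1 - (r : ℝ)) * (1 + r) ≤ Real.exp (-r) * (1 + r) :=
    mul_le_mul_of_nonneg_right h1 (by positivity)
  simp only [pow_zero, pow_one, Nat.factorial_zero, Nat.factorial_one, Nat.cast_one]
  nlinarith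

end Counts

/-! ### Simplicity of the unit rate process and existence of a unique first point. -/

section UnitRate

variable {Ω : Type*} [MeasurableSpace Ω] {μ : Measure Ω} {T : ℕ → Ω → ℝ}

lemma IsPoissonPP.ae_pos (h : IsPoissonPP μ (volume.restrict (Ici 0)) T) :
    ∀ᵐ ω ∂μ, ∀ i, 0 < T i ω := by
  have := h.ae_forall_notMem (B := Iic 0) measurableSet_Iic
    (by rw [Measure.restrict_apply measurableSet_Iic, Iic_inter_Ici]; simp)
  filter_upwards [this] with ω hω i
  exact not_le.1 (hω i)

/-- Two coinciding points in `[0, M)` share a cell of the partition into `M * (n + 1)` cells of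
length `1 / (n + 1)`. The probability that some cell holds two points is at most `M / (n + 1)`, for
every `n`. -/
lemma IsPoissonPP.ae_injective (h : IsPoissonPP μ (volume.restrict (Ici 0)) T) :
    ∀ᵐ ω ∂μ, Function.Injective fun i => T i ω := by
  have hcount : ∀ (ω : Ω) (B : Set ℝ), MeasurableSet B → ∀ i j, i ≠ j → T i ω ∈ B → T j ω ∈ B →
      2 ≤ Measure.sum (fun i => Measure.dirac (T i ω)) B := by
    intro ω B hB i j hij hi hj
    rw [Measure.sum_apply _ hB]
    refine le_trans ?_ (ENNReal.sum_le_tsum {i, j})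
    rw [Finset.sum_pair hij, Measure.dirac_apply' _ hB, Measure.dirac_apply' _ hB,
      indicator_of_mem hi, indicator_of_mem hj]
    simp only [Pi.one_apply]
    norm_num
  have hM : ∀ M : ℕ, μ {ω | ∃ i j, i ≠ j ∧ T i ω = T j ω ∧ 0 ≤ T i ω ∧ T i ω < M} = 0 := by
    intro M
    have hbound : ∀ n : ℕ, μ {ω | ∃ i j, i ≠ j ∧ T i ω = T j ω ∧ 0 ≤ T i ω ∧ T i ω < M} ≤
        ENNReal.ofReal (M / ((n : ℝ) + 1)) := by
      intro n
      have hn : (0 : ℝ) < (n : ℝ) + 1 := by positivity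
      set I : ℕ → Set ℝ := fun k => Ico (k / ((n : ℝ) + 1)) ((k + 1) / ((n : ℝ) + 1)) with hI
      have hIm : ∀ k, MeasurableSet (I k) := fun k => measurableSet_Ico
      have hvol : ∀ k, (volume.restrict (Ici (0 : ℝ))) (I k) ≤ ENNReal.ofReal (1 / ((n : ℝ) + 1)) := by
        intro k
        refine (Measure.restrict_apply_le _ _).trans ?_
        rw [hI, Real.volume_Ico, ← sub_div]
        simp
      calc μ {ω | ∃ i j, i ≠ j ∧ T i ω = T j ω ∧ 0 ≤ T i ω ∧ T i ω < M}
          ≤ μ (⋃ k ∈ Finset.range (M * (n + 1)),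
              {ω | 2 ≤ Measure.sum (fun i => Measure.dirac (T i ω)) (I k)}) := by
            refine measure_mono ?_
            rintro ω ⟨i, j, hij, heq, h0, hlt⟩
            have hnn : 0 ≤ T i ω * ((n : ℝ) + 1) := by positivity
            have hmem : T i ω ∈ I ⌊T i ω * ((n : ℝ) + 1)⌋₊ :=
              ⟨(div_le_iff₀ hn).2 (Nat.floor_le hnn), (lt_div_iff₀ hn).2 (Nat.lt_floor_add_one _)⟩
            refine mem_iUnion₂.2 ⟨⌊T i ω * ((n : ℝ) + 1)⌋₊, ?_,
              hcount ω _ (hIm _) i j hij hmem (heq ▸ hmem)⟩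
            rw [Finset.mem_range, Nat.floor_lt hnn]
            push_cast
            exact mul_lt_mul_of_pos_right hlt hn
        _ ≤ ∑ k ∈ Finset.range (M * (n + 1)), ENNReal.ofReal (1 / ((n : ℝ) + 1)) ^ 2 := by
            refine (measure_biUnion_finset_le _ _).trans (Finset.sum_le_sum fun k _ => ?_)
            refine (h.measure_two_le_count (hIm k) ?_).trans (pow_le_pow_left' (hvol k) 2)
            exact ne_top_of_le_ne_top ENNReal.ofReal_ne_top (hvol k)
        _ = ENNReal.ofReal (M / ((n : ℝ) + 1)) := by
            rw [Finset.sum_const, Finset.card_range, nsmul_eq_mul,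
              ← ENNReal.ofReal_pow (by positivity), ← ENNReal.ofReal_natCast,
              ← ENNReal.ofReal_mul (by positivity)]
            congr 1
            push_cast
            field_simp
    have hlim : Tendsto (fun n : ℕ => ENNReal.ofReal (M / ((n : ℝ) + 1))) atTop (𝓝 0) := by
      rw [← ENNReal.ofReal_zero]
      refine (ENNReal.continuous_ofReal.tendsto 0).comp ?_
      exact tendsto_const_nhds.div_atTop
        (tendsto_atTop_add_const_right _ _ tendsto_natCast_atTop_atTop)
    exact le_antisymm (ge_of_tendsto' hlim hbound) zero_le
  have hall : ∀ᵐ ω ∂μ, ∀ M : ℕ, ¬ ∃ i j, i ≠ j ∧ T i ω = T j ω ∧ 0 ≤ T i ω ∧ T i ω < M :=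
    ae_all_iff.2 fun M => measure_eq_zero_iff_ae_notMem.1 (hM M)
  filter_upwards [hall, h.ae_pos] with ω hω hpos i j hij
  by_contra hne
  obtain ⟨M, hM⟩ := exists_nat_gt (T i ω)
  exact hω M ⟨i, j, hne, hij, (hpos i).le, hM⟩

/-- Only finitely many points lie below a bound exceeding `T 0 ω`, so a minimum exists; injectivity
makes it strict. -/
lemma IsPoissonPP.ae_exists_lt (h : IsPoissonPP μ (volume.restrict (Ici 0)) T) :
    ∀ᵐ ω ∂μ, ∃ i, ∀ j, j ≠ i → T i ω < T j ω := by
  have hfin : ∀ᵐ ω ∂μ, ∀ M : ℕ, {i | T i ω ∈ Icc (0 : ℝ) M}.Finite :=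
    ae_all_iff.2 fun M => h.ae_finite measurableSet_Icc
      (ne_top_of_le_ne_top measure_Icc_lt_top.ne (Measure.restrict_apply_le _ _))
  filter_upwards [hfin, h.ae_pos, h.ae_injective] with ω hω hpos hinj
  obtain ⟨M, hM⟩ := exists_nat_gt (T 0 ω)
  obtain ⟨i, hi, hmin⟩ := (hω M).exists_minimalFor (fun i => T i ω) _ ⟨0, (hpos 0).le, hM.le⟩
  refine ⟨i, fun j hj => ?_⟩
  refine lt_of_le_of_ne ?_ fun heq => hj (hinj heq).symm
  by_contra! hlt
  have hjM : T j ω ∈ Icc (0 : ℝ) M := ⟨(hpos j).le, hlt.le.trans hi.2⟩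
  exact absurd (hmin hjM hlt.le) (not_le.2 hlt)

end UnitRate

/-! ### The exponential distribution of mean one. -/

section Exponential

lemma expMeasure_one_Ici {a : ℝ} (ha : 0 ≤ a) :
    expMeasure 1 (Ici a) = ENNReal.ofReal (Real.exp (-a)) := by
  rw [expMeasure, gammaMeasure, withDensity_apply _ measurableSet_Ici]
  have h1 : ∫⁻ x in Ici a, gammaPDF 1 1 x = ∫⁻ x in Ici a, ENNReal.ofReal (Real.exp (-x)) := by
    refine setLIntegral_congr_fun measurableSet_Ici fun x hx => ?_
    have := exponentialPDF_of_nonneg (r := 1) (ha.trans hx)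
    simpa [exponentialPDF, exponentialPDFReal, gammaPDF] using this
  rw [h1, setLIntegral_congr Ioi_ae_eq_Ici.symm,
    ← ofReal_integral_eq_lintegral_ofReal (integrableOn_exp_neg_Ioi a)
      (ae_of_all _ fun x => (Real.exp_pos _).le), integral_exp_neg_Ioi]

instance : IsProbabilityMeasure (expMeasure 1) := isProbabilityMeasure_expMeasure one_pos

lemma lintegral_expMeasure_one (f : ℝ → ℝ≥0∞) (hf : Measurable f) :
    ∫⁻ x, f x ∂(expMeasure 1) = ∫⁻ x in Ioi 0, ENNReal.ofReal (Real.exp (-x)) * f x := by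
  have hpdf : Measurable (gammaPDF 1 1) := (measurable_gammaPDFReal 1 1).ennreal_ofReal
  rw [expMeasure, gammaMeasure, lintegral_withDensity_eq_lintegral_mul _ hpdf hf, ← setLIntegral_congr Ioi_ae_eq_Ici.symm,
    ← lintegral_indicator measurableSet_Ici]
  refine lintegral_congr fun x => ?_
  rw [Pi.mul_apply]
  by_cases hx : 0 ≤ x
  · rw [indicator_of_mem (mem_Ici.2 hx)]
    congr 1
    have := exponentialPDF_of_nonneg (r := 1) hx
    simpa [exponentialPDF, exponentialPDFReal, gammaPDF] using this
  · rw [indicator_of_notMem (by simpa using hx), gammaPDF_of_neg (not_le.1 hx), zero_mul]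

end Exponential

/-! ### Dyadic approximation, used to discretise the first point. -/

section Dyadic

/-- The largest multiple of `2⁻ⁿ` that is at most `x`, for `0 ≤ x`. -/
def dyadicFloor (n : ℕ) (x : ℝ) : ℝ := ⌊2 ^ n * x⌋₊ / 2 ^ n

/-- The least multiple of `2⁻ⁿ` that is larger than `x`, for `0 ≤ x`. -/
def dyadicSucc (n : ℕ) (x : ℝ) : ℝ := (⌊2 ^ n * x⌋₊ + 1) / 2 ^ n

lemma dyadicFloor_nonneg (n : ℕ) (x : ℝ) : 0 ≤ dyadicFloor n x := by
  unfold dyadicFloor; positivity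

lemma dyadicFloor_le (n : ℕ) {x : ℝ} (hx : 0 ≤ x) : dyadicFloor n x ≤ x := by
  rw [dyadicFloor, div_le_iff₀ (by positivity), mul_comm x]
  exact Nat.floor_le (by positivity)

lemma lt_dyadicSucc (n : ℕ) (x : ℝ) : x < dyadicSucc n x := by
  rw [dyadicSucc, lt_div_iff₀ (by positivity), mul_comm x]
  exact Nat.lt_floor_add_one _

lemma dyadicSucc_eq (n : ℕ) (x : ℝ) : dyadicSucc n x = dyadicFloor n x + (1 / 2) ^ n := by
  rw [dyadicSucc, dyadicFloor, add_div, one_div_pow]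

lemma monotone_dyadicFloor {x : ℝ} (hx : 0 ≤ x) : Monotone fun n => dyadicFloor n x := by
  refine monotone_nat_of_le_succ fun n => ?_
  have h1 : (⌊2 ^ n * x⌋₊ : ℝ) ≤ 2 ^ n * x := Nat.floor_le (by positivity)
  have h2 : 2 * ⌊2 ^ n * x⌋₊ ≤ ⌊2 ^ (n + 1) * x⌋₊ := by
    refine Nat.le_floor ?_
    push_cast
    rw [pow_succ]
    linarith
  have h3 : (2 : ℝ) * ⌊2 ^ n * x⌋₊ ≤ ⌊2 ^ (n + 1) * x⌋₊ := by exact_mod_cast h2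
  rw [dyadicFloor, dyadicFloor, div_le_div_iff₀ (by positivity) (by positivity)]
  generalize ⌊2 ^ (n + 1) * x⌋₊ = q at *
  rw [pow_succ]
  have : (0 : ℝ) < 2 ^ n := by positivity
  nlinarith

lemma antitone_dyadicSucc {x : ℝ} (hx : 0 ≤ x) : Antitone fun n => dyadicSucc n x := by
  refine antitone_nat_of_succ_le fun n => ?_
  have h1 : 2 ^ n * x < ⌊2 ^ n * x⌋₊ + 1 := Nat.lt_floor_add_one _
  have h2 : ⌊2 ^ (n + 1) * x⌋₊ < 2 * (⌊2 ^ n * x⌋₊ + 1) := by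
    rw [Nat.floor_lt (by positivity)]
    push_cast
    rw [pow_succ]
    linarith
  have h3 : (⌊2 ^ (n + 1) * x⌋₊ + 1 : ℝ) ≤ 2 * (⌊2 ^ n * x⌋₊ + 1) := by exact_mod_cast h2
  rw [dyadicSucc, dyadicSucc, div_le_div_iff₀ (by positivity) (by positivity)]
  generalize ⌊2 ^ (n + 1) * x⌋₊ = q at *
  rw [pow_succ]
  have : (0 : ℝ) < 2 ^ n := by positivity
  nlinarith

lemma tendsto_half_pow : Tendsto (fun n : ℕ => (1 / 2 : ℝ) ^ n) atTop (𝓝 0) :=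
  tendsto_pow_atTop_nhds_zero_of_lt_one (by norm_num) (by norm_num)

lemma tendsto_dyadicFloor {x : ℝ} (hx : 0 ≤ x) :
    Tendsto (fun n => dyadicFloor n x) atTop (𝓝 x) := by
  refine tendsto_of_tendsto_of_tendsto_of_le_of_le (g := fun n => x - (1 / 2) ^ n) ?_
    tendsto_const_nhds (fun n => ?_) fun n => dyadicFloor_le n hx
  · simpa using tendsto_const_nhds.sub tendsto_half_pow
  · have := lt_dyadicSucc n x
    rw [dyadicSucc_eq] at this
    simp only
    linarith

lemma tendsto_dyadicFloor_nhdsWithin {x : ℝ} (hx : 0 ≤ x) :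
    Tendsto (fun n => dyadicFloor n x) atTop (𝓝[Ici 0] x) :=
  tendsto_nhdsWithin_iff.2
    ⟨tendsto_dyadicFloor hx, Eventually.of_forall fun n => dyadicFloor_nonneg n x⟩

lemma tendsto_dyadicSucc {x : ℝ} (hx : 0 ≤ x) :
    Tendsto (fun n => dyadicSucc n x) atTop (𝓝 x) := by
  simp_rw [dyadicSucc_eq]
  simpa using (tendsto_dyadicFloor hx).add tendsto_half_pow

lemma measurable_dyadicFloor (n : ℕ) : Measurable (dyadicFloor n) :=
  (measurable_from_top.comp
    (Nat.measurable_floor.comp (measurable_const_mul ((2 : ℝ) ^ n)))).div_const _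

lemma measurable_dyadicSucc (n : ℕ) : Measurable (dyadicSucc n) := by
  have : dyadicSucc n = fun x => dyadicFloor n x + (1 / 2) ^ n := funext (dyadicSucc_eq n)
  rw [this]
  exact (measurable_dyadicFloor n).add_const _

/-- Monotone convergence along the dyadic approximations of a point `x`. -/
lemma tendsto_lintegral_dyadic (κ : Measure ℝ) {φ : ℝ → ℝ → ℝ≥0∞} (hφ : ∀ r, Measurable (φ r))
    (hmono : ∀ t, 0 < t → MonotoneOn (fun r => φ r t) (Ici 0))
    (hcont : ∀ t, 0 < t → ContinuousOn (fun r => φ r t) (Ici 0)) {x : ℝ} (hx : 0 ≤ x) :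
    Tendsto (fun n => ∫⁻ t, (Ici (dyadicSucc n x)).indicator (φ (dyadicFloor n x)) t ∂κ) atTop
      (𝓝 (∫⁻ t, (Ioi x).indicator (φ x) t ∂κ)) := by
  refine lintegral_tendsto_of_tendsto_of_monotone
    (fun n => ((hφ _).indicator measurableSet_Ici).aemeasurable)
    (ae_of_all _ fun t m n hmn => ?_) (ae_of_all _ fun t => ?_)
  · by_cases ht : t ∈ Ici (dyadicSucc m x)
    · have ht' : t ∈ Ici (dyadicSucc n x) := (antitone_dyadicSucc hx hmn).trans ht
      have ht0 : 0 < t := (hx.trans_lt (lt_dyadicSucc m x)).trans_le ht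
      simp only [indicator_of_mem ht, indicator_of_mem ht']
      exact hmono t ht0 (dyadicFloor_nonneg _ _) (dyadicFloor_nonneg _ _)
        (monotone_dyadicFloor hx hmn)
    · simp only [indicator_of_notMem ht]
      exact zero_le
  · by_cases ht : x < t
    · rw [indicator_of_mem (mem_Ioi.2 ht)]
      have h1 : Tendsto (fun n => φ (dyadicFloor n x) t) atTop (𝓝 (φ x t)) :=
        Tendsto.comp (hcont t (hx.trans_lt ht) x hx) (tendsto_dyadicFloor_nhdsWithin hx)
      refine h1.congr' ?_
      filter_upwards [(tendsto_dyadicSucc hx).eventually_lt_const ht] with n hn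
      exact (indicator_of_mem (mem_Ici.2 hn.le) _).symm
    · rw [indicator_of_notMem (by simpa using ht)]
      refine tendsto_const_nhds.congr fun n => ?_
      -- Since `x < dyadicSucc n x` strictly, `t = x` is excluded at every stage. Hence the limit
      -- lives on `Ioi x`, and the first point does not count itself.
      exact (indicator_of_notMem
        (by simpa using (not_lt.1 ht).trans_lt (lt_dyadicSucc n x)) _).symm

end Dyadic

/-! ### The process seen from its first point. -/

section FirstPoint

lemma measurable_indicator_Ici {Ω : Type*} [MeasurableSpace Ω] {f : ℝ → ℝ → ℝ≥0∞}
    (hf : Measurable (Function.uncurry f)) {α β τ : Ω → ℝ} (hα : Measurable α) (hβ : Measurable β)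
    (hτ : Measurable τ) : Measurable fun ω => (Ici (β ω)).indicator (f (α ω)) (τ ω) := by
  have : (fun ω => (Ici (β ω)).indicator (f (α ω)) (τ ω)) =
      {ω | β ω ≤ τ ω}.indicator (fun ω => Function.uncurry f (α ω, τ ω)) := by
    ext ω
    by_cases hω : β ω ≤ τ ω <;> simp [indicator, hω]
  rw [this]
  exact Measurable.indicator (hf.comp (hα.prodMk hτ)) (measurableSet_le hβ hτ)

lemma measurable_lintegral_indicator_Ici {Ω : Type*} [MeasurableSpace Ω] {f : ℝ → ℝ → ℝ≥0∞}
    (hf : Measurable (Function.uncurry f)) {α β : Ω → ℝ} (hα : Measurable α) (hβ : Measurable β) :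
    Measurable fun ω => ∫⁻ t, (Ici (β ω)).indicator (f (α ω)) t :=
  (measurable_indicator_Ici hf (hα.comp measurable_fst) (hβ.comp measurable_fst)
    measurable_snd).lintegral_prod_right'
    (f := fun p : Ω × ℝ => (Ici (β p.1)).indicator (f (α p.1)) p.2)

variable {Ω : Type*} [MeasurableSpace Ω] {μ : Measure Ω} {T : ℕ → Ω → ℝ}

lemma measurableSet_forall_le (hT : ∀ i, Measurable (T i)) (a : ℝ) :
    MeasurableSet {ω | ∀ i, a ≤ T i ω} := by
  simp only [ofPred_forall]
  exact MeasurableSet.iInter fun i => measurableSet_le measurable_const (hT i)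

/-- Giving the test function the value `∞` on `Iio a` makes `expNeg` vanish as soon as a point lies
below `a`, so the event is absorbed into the Laplace functional. On the other side `[0, a)` then
contributes `a` to the exponent. -/
lemma IsPoissonPP.setLIntegral_forall_le [IsProbabilityMeasure μ]
    (h : IsPoissonPP μ (volume.restrict (Ici 0)) T) {a b : ℝ} (ha : 0 ≤ a) (hab : a ≤ b)
    {g : ℝ → ℝ≥0∞} (hg : Measurable g) :
    ∫⁻ ω in {ω | ∀ i, a ≤ T i ω}, expNeg (∑' i, (Ici b).indicator g (T i ω)) ∂μ =
      ENNReal.ofReal (Real.exp (-a)) * expNeg (∫⁻ t in Ici b, (1 - expNeg (g t))) := by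
  classical
  set φ : ℝ → ℝ≥0∞ := fun t => (Iio a).indicator (fun _ => ∞) t + (Ici b).indicator g t with hφ
  have hφm : Measurable φ :=
    (measurable_const.indicator measurableSet_Iio).add (hg.indicator measurableSet_Ici)
  have hL := h.lintegral_expNeg hφm
  have h1 : ∀ ω, expNeg (∑' i, φ (T i ω)) = {ω | ∀ i, a ≤ T i ω}.indicator
      (fun ω => expNeg (∑' i, (Ici b).indicator g (T i ω))) ω := by
    intro ω
    by_cases hω : ∀ i, a ≤ T i ω
    · rw [indicator_of_mem (by exact hω)]
      congr 1
      refine tsum_congr fun i => ?_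
      rw [hφ]
      simp [not_lt.2 (hω i)]
    · rw [indicator_of_notMem (by exact hω)]
      push Not at hω
      obtain ⟨i, hi⟩ := hω
      have : ∑' i, φ (T i ω) = ∞ := by
        refine ENNReal.tsum_eq_top_of_eq_top ⟨i, ?_⟩
        simp [hφ, hi]
      rw [this, expNeg_top]
  simp_rw [h1] at hL
  rw [lintegral_indicator (measurableSet_forall_le h.measurable a)] at hL
  rw [hL, ← expNeg_ofReal ha, ← expNeg_add]
  congr 1
  have h2 : ∀ t, 1 - expNeg (φ t) = (Iio a).indicator (fun _ => 1) t +
      (Ici b).indicator (fun t => 1 - expNeg (g t)) t := by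
    intro t
    rcases lt_or_ge t a with hta | hta
    · have : ¬ b ≤ t := not_le.2 (hta.trans_le hab)
      simp [hφ, hta, this, expNeg_top]
    · by_cases hbt : b ≤ t
      · simp [hφ, not_lt.2 hta, hbt]
      · simp [hφ, not_lt.2 hta, hbt, expNeg_zero]
  simp_rw [h2]
  rw [lintegral_add_left (measurable_const.indicator measurableSet_Iio),
    lintegral_indicator measurableSet_Iio, lintegral_indicator measurableSet_Ici,
    Measure.restrict_restrict measurableSet_Iio, Measure.restrict_restrict measurableSet_Ici,
    inter_eq_left.2 (Ici_subset_Ici.2 (ha.trans hab)), inter_comm, Ici_inter_Iio]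
  simp

lemma IsPoissonPP.measure_forall_le [IsProbabilityMeasure μ]
    (h : IsPoissonPP μ (volume.restrict (Ici 0)) T) {a : ℝ} (ha : 0 ≤ a) :
    μ {ω | ∀ i, a ≤ T i ω} = ENNReal.ofReal (Real.exp (-a)) := by
  have := h.setLIntegral_forall_le ha le_rfl (g := 0) measurable_zero
  simpa [expNeg_zero] using this

/-- Conditionally on the first point lying in `[a, b)`, the points beyond `b` form a Poisson
process. -/
lemma IsPoissonPP.setLIntegral_first_mem_Ico [IsProbabilityMeasure μ]
    (h : IsPoissonPP μ (volume.restrict (Ici 0)) T) {a b : ℝ} (ha : 0 ≤ a) (hab : a ≤ b)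
    {g : ℝ → ℝ≥0∞} (hg : Measurable g) (c : ℝ≥0∞) :
    ∫⁻ ω in {ω | ∀ i, a ≤ T i ω} \ {ω | ∀ i, b ≤ T i ω},
        expNeg (c + ∑' i, (Ici b).indicator g (T i ω)) ∂μ =
      ∫⁻ _ω in {ω | ∀ i, a ≤ T i ω} \ {ω | ∀ i, b ≤ T i ω},
        expNeg (c + ∫⁻ t in Ici b, (1 - expNeg (g t))) ∂μ := by
  have hbm := measurableSet_forall_le h.measurable b
  have hsub : {ω | ∀ i, b ≤ T i ω} ⊆ {ω | ∀ i, a ≤ T i ω} := fun ω hω i => hab.trans (hω i)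
  have hgm : Measurable fun ω => expNeg (∑' i, (Ici b).indicator g (T i ω)) :=
    measurable_expNeg.comp (Measurable.tsum fun i =>
      (hg.indicator measurableSet_Ici).comp (h.measurable i))
  simp_rw [expNeg_add]
  rw [lintegral_const_mul _ hgm, setLIntegral_const, mul_assoc]
  congr 1
  -- The event is a difference of nested events. The integrals over both carry the same factor
  -- `expNeg (∫⁻ t in Ici b, (1 - expNeg (g t)))`, which therefore survives the subtraction.
  have h1 := lintegral_inter_add_sdiff (μ := μ)
    (fun ω => expNeg (∑' i, (Ici b).indicator g (T i ω))) {ω | ∀ i, a ≤ T i ω} hbm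
  rw [inter_eq_right.2 hsub, h.setLIntegral_forall_le ha hab hg,
    h.setLIntegral_forall_le (ha.trans hab) le_rfl hg] at h1
  rw [measure_sdiff hsub hbm.nullMeasurableSet (measure_ne_top _ _), h.measure_forall_le ha,
    h.measure_forall_le (ha.trans hab), mul_comm, ENNReal.sub_mul, ← h1]
  · refine (ENNReal.add_sub_cancel_left ?_).symm
    exact ENNReal.mul_ne_top ENNReal.ofReal_ne_top
      (ne_top_of_le_ne_top ENNReal.one_ne_top (expNeg_le_one _))
  · intro _ _
    exact ne_top_of_le_ne_top ENNReal.one_ne_top (expNeg_le_one _)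

/-- The first point is at least `a` exactly when no point lies below `a`, which has probability `exp
(-a)` for `a ≥ 0`. -/
lemma IsPoissonPP.hasLaw_first [IsProbabilityMeasure μ]
    (h : IsPoissonPP μ (volume.restrict (Ici 0)) T) {m : Ω → ℝ} (hm : Measurable m)
    (hleast : ∀ᵐ ω ∂μ, IsLeast (range fun i => T i ω) (m ω)) :
    HasLaw m (expMeasure 1) μ := by
  refine ⟨hm.aemeasurable, ?_⟩
  have : IsProbabilityMeasure (μ.map m) := Measure.isProbabilityMeasure_map hm.aemeasurable
  have key : ∀ a : ℝ, 0 ≤ a → μ.map m (Ici a) = ENNReal.ofReal (Real.exp (-a)) := by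
    intro a ha
    rw [Measure.map_apply hm measurableSet_Ici, ← h.measure_forall_le ha]
    refine measure_congr ?_
    filter_upwards [hleast] with ω hω
    refine propext ⟨fun hmem i => ?_, fun hall => ?_⟩
    · exact le_trans (show a ≤ m ω from hmem) (hω.2 ⟨i, rfl⟩)
    · obtain ⟨i, hi⟩ := hω.1
      exact (hall i).trans_eq hi
  refine Measure.ext_of_Ici _ _ fun a => ?_
  rcases le_total 0 a with ha | ha
  · rw [key a ha, expMeasure_one_Ici ha]
  · have one : ∀ (κ : Measure ℝ) [IsProbabilityMeasure κ], κ (Ici 0) = 1 → κ (Ici a) = 1 :=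
      fun κ _ hκ => le_antisymm prob_le_one (hκ.symm.le.trans (measure_mono (Ici_subset_Ici.2 ha)))
    rw [one _ (by rw [key 0 le_rfl]; simp), one _ (by rw [expMeasure_one_Ici le_rfl]; simp)]

/-- Where `⌊2 ^ n * m⌋₊ = k`, the first point lies in `[k / 2 ^ n, (k + 1) / 2 ^ n)` and both dyadic
approximations are constant, so `setLIntegral_first_mem_Ico` applies cell by cell. -/
lemma IsPoissonPP.lintegral_dyadic [IsProbabilityMeasure μ]
    (h : IsPoissonPP μ (volume.restrict (Ici 0)) T) {m : Ω → ℝ} (hm : Measurable m)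
    (hleast : ∀ᵐ ω ∂μ, IsLeast (range fun i => T i ω) (m ω))
    {c : ℝ → ℝ≥0∞} {φ : ℝ → ℝ → ℝ≥0∞} (hφ : ∀ r, Measurable (φ r)) (n : ℕ) :
    ∫⁻ ω, expNeg (c (dyadicFloor n (m ω)) + ∑' i,
        (Ici (dyadicSucc n (m ω))).indicator (φ (dyadicFloor n (m ω))) (T i ω)) ∂μ =
      ∫⁻ ω, expNeg (c (dyadicFloor n (m ω)) + ∫⁻ t in Ici (dyadicSucc n (m ω)),
        (1 - expNeg (φ (dyadicFloor n (m ω)) t))) ∂μ := by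
  set S : ℕ → Set Ω := fun k => {ω | ⌊2 ^ n * m ω⌋₊ = k} with hS
  have hSm : ∀ k, MeasurableSet (S k) := fun k =>
    (Nat.measurable_floor.comp (hm.const_mul _)) (measurableSet_singleton k)
  have hSd : Pairwise (Function.onFun Disjoint S) := by
    intro k l hkl
    refine Set.disjoint_left.2 fun ω hk hl => hkl ?_
    rw [← show ⌊2 ^ n * m ω⌋₊ = k from hk, ← show ⌊2 ^ n * m ω⌋₊ = l from hl]
  have hSu : ⋃ k, S k = univ := eq_univ_of_forall fun ω => mem_iUnion.2 ⟨_, rfl⟩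
  have hsplit : ∀ f : Ω → ℝ≥0∞, ∫⁻ ω, f ω ∂μ = ∑' k, ∫⁻ ω in S k, f ω ∂μ := by
    intro f
    rw [← lintegral_iUnion hSm hSd, hSu, Measure.restrict_univ]
  rw [hsplit, hsplit]
  refine tsum_congr fun k => ?_
  have hk : ∀ ω ∈ S k, dyadicFloor n (m ω) = k / 2 ^ n ∧ dyadicSucc n (m ω) = (k + 1) / 2 ^ n := by
    intro ω hω
    rw [dyadicFloor, dyadicSucc, show ⌊2 ^ n * m ω⌋₊ = k from hω]
    exact ⟨rfl, rfl⟩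
  have hle : (k : ℝ) / 2 ^ n ≤ (k + 1) / 2 ^ n := by gcongr; linarith
  have hset : S k =ᵐ[μ] ({ω | ∀ i, (k : ℝ) / 2 ^ n ≤ T i ω} \
      {ω | ∀ i, ((k : ℝ) + 1) / 2 ^ n ≤ T i ω} : Set Ω) := by
    filter_upwards [hleast, h.ae_pos] with ω hω hpos
    obtain ⟨i₀, hi₀⟩ := hω.1
    simp only at hi₀
    have hm0 : 0 ≤ 2 ^ n * m ω := by rw [← hi₀]; have := hpos i₀; positivity
    have hiff : ∀ a : ℝ, (∀ i, a ≤ T i ω) ↔ a ≤ m ω := fun a =>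
      ⟨fun hall => (hall i₀).trans_eq hi₀, fun ha i => ha.trans (hω.2 ⟨i, rfl⟩)⟩
    refine propext ?_
    change ⌊2 ^ n * m ω⌋₊ = k ↔ (∀ i, (k : ℝ) / 2 ^ n ≤ T i ω) ∧
      ¬ ∀ i, ((k : ℝ) + 1) / 2 ^ n ≤ T i ω
    rw [hiff, hiff, not_le, div_le_iff₀ (by positivity), lt_div_iff₀ (by positivity),
      Nat.floor_eq_iff hm0, mul_comm (m ω)]
  have hleft : ∀ ω ∈ S k, expNeg (c (dyadicFloor n (m ω)) + ∑' i,
      (Ici (dyadicSucc n (m ω))).indicator (φ (dyadicFloor n (m ω))) (T i ω)) =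
      expNeg (c (k / 2 ^ n) + ∑' i, (Ici (((k : ℝ) + 1) / 2 ^ n)).indicator (φ (k / 2 ^ n))
        (T i ω)) := fun ω hω => by rw [(hk ω hω).1, (hk ω hω).2]
  have hright : ∀ ω ∈ S k, expNeg (c (dyadicFloor n (m ω)) + ∫⁻ t in Ici (dyadicSucc n (m ω)),
      (1 - expNeg (φ (dyadicFloor n (m ω)) t))) =
      expNeg (c (k / 2 ^ n) + ∫⁻ t in Ici (((k : ℝ) + 1) / 2 ^ n),
        (1 - expNeg (φ (k / 2 ^ n) t))) := fun ω hω => by rw [(hk ω hω).1, (hk ω hω).2]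
  rw [setLIntegral_congr_fun (hSm k) hleft, setLIntegral_congr_fun (hSm k) hright,
    setLIntegral_congr hset, setLIntegral_congr hset]
  exact h.setLIntegral_first_mem_Ico (by positivity) hle (hφ _) _

/-- The strong Markov property of a unit rate Poisson process at its first point `m`: given
`m = u`, the remaining points form a unit rate Poisson process on `(u, ∞)`. -/
theorem IsPoissonPP.lintegral_first [IsProbabilityMeasure μ]
    (h : IsPoissonPP μ (volume.restrict (Ici 0)) T) {m : Ω → ℝ} (hm : Measurable m)
    (hleast : ∀ᵐ ω ∂μ, IsLeast (range fun i => T i ω) (m ω))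
    {c : ℝ → ℝ≥0∞} (hc : Measurable c) (hccont : ContinuousOn c (Ici 0))
    {φ : ℝ → ℝ → ℝ≥0∞} (hφ : Measurable (Function.uncurry φ))
    (hmono : ∀ t, 0 < t → MonotoneOn (fun r => φ r t) (Ici 0))
    (hcont : ∀ t, 0 < t → ContinuousOn (fun r => φ r t) (Ici 0)) :
    ∫⁻ ω, expNeg (c (m ω) + ∑' i, (Ioi (m ω)).indicator (φ (m ω)) (T i ω)) ∂μ =
      ∫⁻ u in Ioi 0, ENNReal.ofReal (Real.exp (-u)) *
        expNeg (c u + ∫⁻ t in Ioi u, (1 - expNeg (φ u t))) := by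
  have hφr : ∀ r, Measurable (φ r) := fun r => hφ.of_uncurry_left
  set ψ : ℝ → ℝ → ℝ≥0∞ := fun r t => 1 - expNeg (φ r t) with hψ
  have hψm : Measurable (Function.uncurry ψ) := measurable_const.sub (measurable_expNeg.comp hφ)
  have hψr : ∀ r, Measurable (ψ r) := fun r => hψm.of_uncurry_left
  have hψmono : ∀ t, 0 < t → MonotoneOn (fun r => ψ r t) (Ici 0) := fun t ht r hr r' hr' hrr' =>
    tsub_le_tsub_left (expNeg_antitone (hmono t ht hr hr' hrr')) _
  have hψcont : ∀ t, 0 < t → ContinuousOn (fun r => ψ r t) (Ici 0) := fun t ht r hr =>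
    ENNReal.Tendsto.sub tendsto_const_nhds
      ((continuous_expNeg.tendsto _).comp (hcont t ht r hr)) (Or.inl (by simp))
  have hm0 : ∀ᵐ ω ∂μ, 0 ≤ m ω := by
    filter_upwards [hleast, h.ae_pos] with ω hω hpos
    obtain ⟨i, hi⟩ := hω.1
    exact hi ▸ (hpos i).le
  have hclim : ∀ x, 0 ≤ x → Tendsto (fun n => c (dyadicFloor n x)) atTop (𝓝 (c x)) := by
    intro x hx
    have h1 := hccont x (mem_Ici.2 hx)
    exact h1.tendsto.comp (tendsto_dyadicFloor_nhdsWithin hx)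
  have hF : ∀ n, Measurable fun ω => dyadicFloor n (m ω) := fun n =>
    (measurable_dyadicFloor n).comp hm
  have hS : ∀ n, Measurable fun ω => dyadicSucc n (m ω) := fun n =>
    (measurable_dyadicSucc n).comp hm
  -- For fixed `ω` the sum over points is an integral against a counting measure, so the same
  -- monotone limit serves here and, with Lebesgue measure, in `hR`. Boundedness by `1` handles the
  -- expectation.
  have hL : Tendsto (fun n => ∫⁻ ω, expNeg (c (dyadicFloor n (m ω)) + ∑' i,
      (Ici (dyadicSucc n (m ω))).indicator (φ (dyadicFloor n (m ω))) (T i ω)) ∂μ) atTop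
      (𝓝 (∫⁻ ω, expNeg (c (m ω) + ∑' i, (Ioi (m ω)).indicator (φ (m ω)) (T i ω)) ∂μ)) := by
    refine tendsto_lintegral_of_dominated_convergence (fun _ => 1) (fun n => ?_)
      (fun n => ae_of_all _ fun ω => expNeg_le_one _) (by simp) ?_
    · exact measurable_expNeg.comp ((hc.comp (hF n)).add
        (Measurable.tsum fun i => measurable_indicator_Ici hφ (hF n) (hS n) (h.measurable i)))
    · filter_upwards [hm0] with ω hω
      have := tendsto_lintegral_dyadic (Measure.sum fun i => Measure.dirac (T i ω)) hφr hmono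
        hcont hω
      simp_rw [lintegral_sum_dirac T ((hφr _).indicator measurableSet_Ici),
        lintegral_sum_dirac T ((hφr _).indicator measurableSet_Ioi)] at this
      exact (continuous_expNeg.tendsto _).comp ((hclim _ hω).add this)
  have hmeas : ∀ n, Measurable fun ω =>
      ∫⁻ t, (Ici (dyadicSucc n (m ω))).indicator (ψ (dyadicFloor n (m ω))) t := fun n =>
    measurable_lintegral_indicator_Ici hψm (hF n) (hS n)
  have hR : Tendsto (fun n => ∫⁻ ω, expNeg (c (dyadicFloor n (m ω)) +
      ∫⁻ t in Ici (dyadicSucc n (m ω)), ψ (dyadicFloor n (m ω)) t) ∂μ) atTop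
      (𝓝 (∫⁻ ω, expNeg (c (m ω) + ∫⁻ t in Ioi (m ω), ψ (m ω) t) ∂μ)) := by
    simp_rw [← lintegral_indicator measurableSet_Ici, ← lintegral_indicator measurableSet_Ioi]
    refine tendsto_lintegral_of_dominated_convergence (fun _ => 1) (fun n => ?_)
      (fun n => ae_of_all _ fun ω => expNeg_le_one _) (by simp) ?_
    · exact measurable_expNeg.comp ((hc.comp (hF n)).add (hmeas n))
    · filter_upwards [hm0] with ω hω
      have := tendsto_lintegral_dyadic volume hψr hψmono hψcont hω
      exact (continuous_expNeg.tendsto _).comp ((hclim _ hω).add this)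
  have heq := tendsto_nhds_unique hL
    (hR.congr fun n => (h.lintegral_dyadic hm hleast hφr n).symm)
  have hgm : Measurable fun u => expNeg (c u + ∫⁻ t in Ioi u, ψ u t) := by
    simp_rw [← setLIntegral_congr (Ioi_ae_eq_Ici (α := ℝ)).symm,
      ← lintegral_indicator measurableSet_Ici]
    exact measurable_expNeg.comp (hc.add
      (measurable_lintegral_indicator_Ici hψm measurable_id measurable_id))
  rw [heq, (h.hasLaw_first hm hleast).lintegral_comp
    (f := fun u => expNeg (c u + ∫⁻ t in Ioi u, ψ u t)) hgm.aemeasurable,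
    lintegral_expMeasure_one _ hgm]

end FirstPoint

/-! ### Rayleigh fading with the positions fixed. -/

section Fading

variable {Ω : Type*} [MeasurableSpace Ω] {μ : Measure Ω}

/-- The Laplace transform of the exponential distribution of mean `1`. -/
lemma lintegral_expNeg_expMeasure_one {a : ℝ} (ha : 0 ≤ a) :
    ∫⁻ x, expNeg (ENNReal.ofReal (x * a)) ∂(expMeasure 1) =
      expNeg (ENNReal.ofReal (Real.log (1 + a))) := by
  have hpos : 0 < 1 + a := by linarith
  rw [lintegral_expMeasure_one _ (by fun_prop)]
  have h1 : ∫⁻ x in Ioi 0, ENNReal.ofReal (Real.exp (-x)) * expNeg (ENNReal.ofReal (x * a)) =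
      ∫⁻ x in Ioi 0, ENNReal.ofReal (Real.exp (-(1 + a) * x)) := by
    refine setLIntegral_congr_fun measurableSet_Ioi fun x hx => ?_
    have hx' : 0 ≤ x * a := mul_nonneg (le_of_lt hx) ha
    rw [expNeg_ofReal hx', ← ENNReal.ofReal_mul (Real.exp_pos _).le, ← Real.exp_add]
    congr 2
    ring
  rw [h1, ← ofReal_integral_eq_lintegral_ofReal (integrableOn_exp_mul_Ioi (by linarith) 0)
    (ae_of_all _ fun x => (Real.exp_pos _).le), integral_exp_mul_Ioi (by linarith),
    expNeg_ofReal (Real.log_nonneg (by linarith)), Real.exp_neg, Real.exp_log hpos]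
  congr 1
  simp only [mul_zero, Real.exp_zero]
  rw [neg_div_neg_eq, one_div]

lemma expMeasure_one_le_ofReal (w : ℝ≥0∞) :
    expMeasure 1 {y | w ≤ ENNReal.ofReal y} = expNeg w := by
  induction w with
  | top => simp [expNeg_top]
  | coe r =>
    rw [← ENNReal.ofReal_coe_nnreal, expNeg_ofReal r.coe_nonneg]
    rcases eq_or_lt_of_le r.coe_nonneg with hr | hr
    -- For `r = 0` the set is the whole line, negative `y` included, because `ENNReal.ofReal`
    -- truncates at `0`; it is not `Ici 0`.
    · simp [← hr]
    · rw [← expMeasure_one_Ici hr.le]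
      congr 1
      ext y
      change ENNReal.ofReal r ≤ ENNReal.ofReal y ↔ (r : ℝ) ≤ y
      rw [ENNReal.ofReal_le_ofReal_iff']
      constructor
      · rintro (h | h)
        · exact h
        · exact absurd h (not_le.2 hr)
      · exact Or.inl

/-- Conditioning on `W` and using the tail `P(Y ≥ w) = exp (-w)` turns a probability into a Laplace
transform. -/
lemma measure_le_ofReal_of_indepFun [IsProbabilityMeasure μ] {Y : Ω → ℝ} {W : Ω → ℝ≥0∞}
    (hY : HasLaw Y (expMeasure 1) μ) (hYm : Measurable Y) (hW : Measurable W)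
    (hind : IndepFun W Y μ) :
    μ {ω | W ω ≤ ENNReal.ofReal (Y ω)} = ∫⁻ ω, expNeg (W ω) ∂μ := by
  have hS : MeasurableSet {p : ℝ≥0∞ × ℝ | p.1 ≤ ENNReal.ofReal p.2} :=
    measurableSet_le measurable_fst (by fun_prop)
  have h1 : μ {ω | W ω ≤ ENNReal.ofReal (Y ω)} =
      (μ.map fun ω => (W ω, Y ω)) {p : ℝ≥0∞ × ℝ | p.1 ≤ ENNReal.ofReal p.2} := by
    rw [Measure.map_apply (hW.prodMk hYm) hS]
    rfl
  have : IsProbabilityMeasure (μ.map Y) := Measure.isProbabilityMeasure_map hYm.aemeasurable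
  rw [h1, (indepFun_iff_map_prod_eq_prod_map_map hW.aemeasurable hYm.aemeasurable).1 hind,
    Measure.prod_apply hS, lintegral_map (measurable_measure_prodMk_left hS) hW, hY.map_eq]
  exact lintegral_congr fun ω => expMeasure_one_le_ofReal (W ω)

/-- Each factor is `1 / (1 + a j) = expNeg (log (1 + a j))`. Independence settles the partial sums,
and bounded convergence passes to the series. -/
lemma lintegral_expNeg_tsum_fading [IsProbabilityMeasure μ] {Y : ℕ → Ω → ℝ}
    (hY : ∀ j, HasLaw (Y j) (expMeasure 1) μ) (hYm : ∀ j, Measurable (Y j))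
    (hind : iIndepFun Y μ) {a : ℕ → ℝ} (ha : ∀ j, 0 ≤ a j) :
    ∫⁻ ω, expNeg (∑' j, ENNReal.ofReal (Y j ω * a j)) ∂μ =
      expNeg (∑' j, ENNReal.ofReal (Real.log (1 + a j))) := by
  have hfin : ∀ n : ℕ, ∫⁻ ω, expNeg (∑ j ∈ Finset.range n, ENNReal.ofReal (Y j ω * a j)) ∂μ =
      expNeg (∑ j ∈ Finset.range n, ENNReal.ofReal (Real.log (1 + a j))) := by
    intro n
    have hm : ∀ j, Measurable fun y : ℝ => expNeg (ENNReal.ofReal (y * a j)) :=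
      fun j => by fun_prop
    simp_rw [expNeg_sum]
    refine (lintegral_prod_eq_prod_lintegral_of_indepFun (Finset.range n)
      (fun j ω => expNeg (ENNReal.ofReal (Y j ω * a j))) (hind.comp _ hm)
      fun j => (hm j).comp (hYm j)).trans (Finset.prod_congr rfl fun j _ => ?_)
    rw [← lintegral_expNeg_expMeasure_one (ha j)]
    exact (hY j).lintegral_comp (f := fun y => expNeg (ENNReal.ofReal (y * a j)))
      (hm j).aemeasurable
  have hlim : ∀ f : ℕ → ℝ≥0∞, Tendsto (fun n => expNeg (∑ j ∈ Finset.range n, f j)) atTop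
      (𝓝 (expNeg (∑' j, f j))) := fun f =>
    (continuous_expNeg.tendsto _).comp (ENNReal.summable.hasSum.tendsto_sum_nat)
  refine tendsto_nhds_unique (tendsto_lintegral_of_dominated_convergence (fun _ => 1) (fun n => ?_)
    (fun n => ae_of_all _ fun ω => expNeg_le_one _) (by simp)
    (ae_of_all _ fun ω => hlim _)) ((hlim _).congr fun n => (hfin n).symm)
  exact measurable_expNeg.comp (Finset.measurable_sum _ fun j _ =>
    ((hYm j).mul_const _).ennreal_ofReal)

lemma measure_le_fading [IsProbabilityMeasure μ] {Y : ℕ → Ω → ℝ}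
    (hY : ∀ j, HasLaw (Y j) (expMeasure 1) μ) (hYm : ∀ j, Measurable (Y j))
    (hind : iIndepFun Y μ) {a : ℕ → ℝ} (ha : ∀ j, 0 ≤ a j) (c : ℝ≥0∞) (b : ℕ) :
    μ {ω | c + ∑' j : {j // j ≠ b}, ENNReal.ofReal (Y j ω * a j) ≤ ENNReal.ofReal (Y b ω)} =
      expNeg (c + ∑' j : {j // j ≠ b}, ENNReal.ofReal (Real.log (1 + a j))) := by
  -- The σ-algebra is left free: the independence argument needs measurability with respect to the
  -- one generated by `Y j` for `j ≠ b`, and the final steps need it with respect to the ambient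
  -- one.
  have hWm : ∀ (mΩ : MeasurableSpace Ω), (∀ j ≠ b, Measurable[mΩ] (Y j)) →
      Measurable[mΩ] fun ω => c + ∑' j : {j // j ≠ b}, ENNReal.ofReal (Y j ω * a j) := by
    intro mΩ hm
    exact measurable_const.add
      (Measurable.tsum fun j => ((hm j j.2).mul_const _).ennreal_ofReal)
  have hindW : IndepFun (fun ω => c + ∑' j : {j // j ≠ b}, ENNReal.ofReal (Y j ω * a j))
      (Y b) μ := by
    have h1 := indep_iSup_of_disjoint (S := {j | j ≠ b}) (T := {b})
      (fun j => (hYm j).comap_le) ((iIndepFun_iff_iIndep ..).1 hind) (by simp)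
    rw [IndepFun_iff_Indep]
    refine indep_of_indep_of_le_right (indep_of_indep_of_le_left h1 ?_) ?_
    · refine Measurable.comap_le (hWm _ fun j hj => ?_)
      exact Measurable.mono (comap_measurable (Y j))
        (le_iSup₂_of_le (f := fun j (_ : j ∈ {j | j ≠ b}) => MeasurableSpace.comap (Y j) _)
          j hj le_rfl) le_rfl
    · exact le_iSup₂_of_le (f := fun j (_ : j ∈ ({b} : Set ℕ)) => MeasurableSpace.comap (Y j) _)
        b rfl le_rfl
  rw [measure_le_ofReal_of_indepFun (hY b) (hYm b) (hWm _ fun j _ => hYm j) hindW]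
  simp_rw [expNeg_add]
  -- Replacing `a b` by `0` kills the term of index `b` on both sides, so the formula for full
  -- series applies.
  have htsum : ∀ ω, ∑' j : {j // j ≠ b}, ENNReal.ofReal (Y j ω * a j) =
      ∑' j, ENNReal.ofReal (Y j ω * ({b}ᶜ : Set ℕ).indicator a j) := by
    intro ω
    refine (tsum_subtype ({b}ᶜ : Set ℕ) fun j => ENNReal.ofReal (Y j ω * a j)).trans
      (tsum_congr fun j => ?_)
    by_cases hj : j = b <;> simp [hj]
  have htsum' : ∑' j : {j // j ≠ b}, ENNReal.ofReal (Real.log (1 + a j)) =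
      ∑' j, ENNReal.ofReal (Real.log (1 + ({b}ᶜ : Set ℕ).indicator a j)) := by
    refine (tsum_subtype ({b}ᶜ : Set ℕ) fun j => ENNReal.ofReal (Real.log (1 + a j))).trans
      (tsum_congr fun j => ?_)
    by_cases hj : j = b <;> simp [hj]
  simp_rw [htsum]
  rw [htsum', lintegral_const_mul, lintegral_expNeg_tsum_fading hY hYm hind
    fun j => indicator_nonneg (fun j _ => ha j) j]
  exact measurable_expNeg.comp (Measurable.tsum fun j =>
    ((hYm j).mul_const _).ennreal_ofReal)

end Fading

/-! ### The interference integral and the convergence of the double integral. -/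

section Analysis

/-- With `y = (1 / z) ^ (2 / β) * t / u` on the left and `y = v ^ (2 / β)` on the right, both sides
become multiples of the integral of `1 / (1 + y ^ (β / 2))` over `y > (1 / z) ^ (2 / β)`. -/
lemma setIntegral_pathloss {β z u : ℝ} (hβ : 2 < β) (hz : 0 < z) (hu : 0 < u) :
    ∫ t in Ioi u, z * (u / t) ^ (β / 2) / (1 + z * (u / t) ^ (β / 2)) =
      u * (2 * z ^ (2 / β) / β * ∫ v in Ioi (1 / z), v ^ (2 / β - 1) / (1 + v)) := by
  have hβ0 : 0 < β := by linarith
  have hp : 0 < 2 / β := by positivity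
  have hzp : 0 < z ^ (2 / β) := Real.rpow_pos_of_pos hz _
  set g : ℝ → ℝ := fun y => 1 / (1 + y ^ (β / 2)) with hg
  have hroot : ∀ x : ℝ, 0 ≤ x → (x ^ (2 / β)) ^ (β / 2) = x := by
    intro x hx
    rw [← Real.rpow_mul hx, show 2 / β * (β / 2) = 1 by field_simp, Real.rpow_one]
  have h1 : ∫ v in Ioi (1 / z), (2 / β * v ^ (2 / β - 1)) • g (v ^ (2 / β)) =
      ∫ y in Ioi ((1 / z) ^ (2 / β)), g y := by
    have := integral_comp_rpow_Ioi_of_pos' (g := g) hp (c := (1 / z) ^ (2 / β)) (by positivity)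
    rwa [← Real.rpow_mul (by positivity), mul_inv_cancel₀ hp.ne', Real.rpow_one] at this
  have h2 : ∫ v in Ioi (1 / z), (2 / β * v ^ (2 / β - 1)) • g (v ^ (2 / β)) =
      2 / β * ∫ v in Ioi (1 / z), v ^ (2 / β - 1) / (1 + v) := by
    rw [← integral_const_mul]
    refine setIntegral_congr_fun measurableSet_Ioi fun v hv => ?_
    have hv0 : 0 ≤ v := ((by positivity : 0 < 1 / z).trans hv).le
    simp only [hg, smul_eq_mul, hroot v hv0]
    ring
  have h3 := integral_comp_mul_left_Ioi' g u (b := (1 / z) ^ (2 / β) / u) (by positivity)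
  rw [div_mul_cancel₀ _ hu.ne', ← h1, h2, smul_eq_mul] at h3
  have h4 : ∫ t in Ioi u, z * (u / t) ^ (β / 2) / (1 + z * (u / t) ^ (β / 2)) =
      ∫ t in Ioi u, g ((1 / z) ^ (2 / β) / u * t) := by
    refine setIntegral_congr_fun measurableSet_Ioi fun t ht => ?_
    have ht0 : 0 < t := hu.trans ht
    have hpow : ((1 / z) ^ (2 / β) / u * t) ^ (β / 2) = (z * (u / t) ^ (β / 2))⁻¹ := by
      rw [show (1 / z) ^ (2 / β) / u * t = (1 / z) ^ (2 / β) * (u / t)⁻¹ by field_simp,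
        Real.mul_rpow (by positivity) (by positivity), hroot _ (by positivity),
        Real.inv_rpow (by positivity), mul_inv, one_div]
    have hx : 0 < z * (u / t) ^ (β / 2) := by positivity
    simp only [hg, hpow]
    generalize z * (u / t) ^ (β / 2) = x at hx
    field_simp
    ring
  rw [h4]
  have h5 : (1 / z) ^ (2 / β) = (z ^ (2 / β))⁻¹ := by rw [one_div, Real.inv_rpow hz.le]
  rw [h5] at h3 ⊢
  generalize ∫ t in Ioi u, g ((z ^ (2 / β))⁻¹ / u * t) = A at h3
  generalize ∫ v in Ioi (1 / z), v ^ (2 / β - 1) / (1 + v) = J at h3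
  field_simp at h3 ⊢
  linarith

/-- The integrand is at most a multiple of `t ^ (-(β / 2))`, integrable at infinity because `β > 2`.
-/
lemma integrableOn_pathloss {β z u : ℝ} (hβ : 2 < β) (hz : 0 < z) (hu : 0 < u) :
    IntegrableOn (fun t => z * (u / t) ^ (β / 2) / (1 + z * (u / t) ^ (β / 2))) (Ioi u) := by
  have hdom : IntegrableOn (fun t => z * u ^ (β / 2) * t ^ (-(β / 2))) (Ioi u) :=
    (integrableOn_Ioi_rpow_of_lt (by linarith) hu).const_mul _
  refine Integrable.mono' hdom (Measurable.aestronglyMeasurable (by fun_prop)) ?_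
  refine (ae_restrict_iff' measurableSet_Ioi).2 (ae_of_all _ fun t ht => ?_)
  have ht0 : 0 < t := hu.trans ht
  have hx : 0 < z * (u / t) ^ (β / 2) := by positivity
  rw [Real.norm_of_nonneg (by positivity)]
  refine (div_le_self hx.le (by linarith)).trans_eq ?_
  rw [Real.div_rpow hu.le ht0.le, Real.rpow_neg ht0.le]
  ring

lemma one_sub_expNeg_log {x : ℝ} (hx : 0 ≤ x) :
    1 - expNeg (ENNReal.ofReal (Real.log (1 + x))) = ENNReal.ofReal (x / (1 + x)) := by
  have hpos : 0 < 1 + x := by linarith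
  rw [expNeg_ofReal (Real.log_nonneg (by linarith)), Real.exp_neg, Real.exp_log hpos,
    ← ENNReal.ofReal_one, ← ENNReal.ofReal_sub _ (by positivity)]
  congr 1
  field_simp
  ring

lemma lintegral_one_sub_expNeg_pathloss {β z u : ℝ} (hβ : 2 < β) (hz : 0 < z) (hu : 0 < u) :
    ∫⁻ t in Ioi u, (1 - expNeg (ENNReal.ofReal (Real.log (1 + z * (u / t) ^ (β / 2))))) =
      ENNReal.ofReal
        (u * (2 * z ^ (2 / β) / β * ∫ v in Ioi (1 / z), v ^ (2 / β - 1) / (1 + v))) := by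
  rw [← setIntegral_pathloss hβ hz hu, ofReal_integral_eq_lintegral_ofReal
    (integrableOn_pathloss hβ hz hu)]
  · refine setLIntegral_congr_fun measurableSet_Ioi fun t ht => ?_
    have ht0 : 0 < t := hu.trans ht
    exact one_sub_expNeg_log (by positivity)
  · refine (ae_restrict_iff' measurableSet_Ioi).2 (ae_of_all _ fun t ht => ?_)
    have ht0 : 0 < t := hu.trans ht
    simp only [Pi.zero_apply]
    positivity

lemma setIntegral_Ioi_one_div_nonneg {β z : ℝ} (hz : 0 < z) :
    0 ≤ ∫ v in Ioi (1 / z), v ^ (2 / β - 1) / (1 + v) := by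
  refine setIntegral_nonneg measurableSet_Ioi fun v hv => ?_
  have hv0 : 0 < v := (by positivity : 0 < 1 / z).trans hv
  positivity

lemma ofReal_rho1 {σ lam β z u : ℝ} (hlam : 0 < lam) (hβ : 2 < β) (hz : 0 < z) (hu : 0 < u) :
    ENNReal.ofReal (Real.exp (-u)) *
      expNeg (ENNReal.ofReal (σ ^ 2 * z * (u / (Real.pi * lam)) ^ (β / 2)) +
        ∫⁻ t in Ioi u, (1 - expNeg (ENNReal.ofReal (Real.log (1 + z * (u / t) ^ (β / 2)))))) =
      ENNReal.ofReal (rho1 σ lam β z u) := by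
  have hβ0 : 0 < β := by linarith
  have hJ := setIntegral_Ioi_one_div_nonneg (β := β) hz
  rw [lintegral_one_sub_expNeg_pathloss hβ hz hu, ← ENNReal.ofReal_add (by positivity)
    (by positivity), expNeg_ofReal (by positivity), ← ENNReal.ofReal_mul (Real.exp_pos _).le,
    ← Real.exp_add, rho1]
  congr 2
  ring

lemma measurable_setIntegral_Ioi_one_div (β : ℝ) :
    Measurable fun z : ℝ => ∫ v in Ioi (1 / z), v ^ (2 / β - 1) / (1 + v) := by
  simp_rw [← integral_indicator measurableSet_Ioi]
  refine (StronglyMeasurable.integral_prod_right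
    (f := fun z v : ℝ => (Ioi (1 / z)).indicator (fun v => v ^ (2 / β - 1) / (1 + v)) v)
    (Measurable.stronglyMeasurable ?_)).measurable
  have : Function.uncurry
      (fun z v : ℝ => (Ioi (1 / z)).indicator (fun v => v ^ (2 / β - 1) / (1 + v)) v) =
      {p : ℝ × ℝ | 1 / p.1 < p.2}.indicator fun p => p.2 ^ (2 / β - 1) / (1 + p.2) := by
    ext ⟨z, v⟩
    by_cases h : 1 / z < v <;> simp [indicator]
  rw [this]
  exact Measurable.indicator (by fun_prop) (measurableSet_lt (by fun_prop) (by fun_prop))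

lemma measurable_rho1 (σ lam β : ℝ) : Measurable fun p : ℝ × ℝ => rho1 σ lam β p.2 p.1 := by
  have hJ : Measurable fun p : ℝ × ℝ => ∫ v in Ioi (1 / p.2), v ^ (2 / β - 1) / (1 + v) :=
    (measurable_setIntegral_Ioi_one_div β).comp measurable_snd
  unfold rho1
  fun_prop

lemma exp_neg_le_rpow_neg {p y : ℝ} (hp0 : 0 ≤ p) (hp1 : p ≤ 1) (hy : 0 < y) :
    Real.exp (-y) ≤ y ^ (-p) := by
  rw [Real.exp_neg, Real.rpow_neg hy.le]
  refine inv_anti₀ (by positivity) ?_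
  rcases le_total y 1 with h | h
  · exact (Real.rpow_le_one hy.le h hp0).trans (Real.one_le_exp hy.le)
  · calc y ^ p ≤ y ^ (1 : ℝ) := Real.rpow_le_rpow_of_exponent_le h hp1
      _ = y := Real.rpow_one y
      _ ≤ Real.exp y := by linarith [Real.add_one_le_exp y]

lemma integrableOn_rpow_neg_div_one_add {p : ℝ} (hp0 : 0 < p) (hp1 : p < 1) :
    IntegrableOn (fun z : ℝ => z ^ (-p) / (1 + z)) (Ioi 0) := by
  rw [← Ioc_union_Ioi_eq_Ioi zero_le_one]
  refine IntegrableOn.union ?_ ?_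
  · have hdom : IntegrableOn (fun z : ℝ => z ^ (-p)) (Ioc 0 1) := by
      rw [integrableOn_Ioc_iff_integrableOn_Ioo]
      exact (intervalIntegral.integrableOn_Ioo_rpow_iff one_pos).2 (by linarith)
    refine Integrable.mono' hdom (Measurable.aestronglyMeasurable (by fun_prop)) ?_
    refine (ae_restrict_iff' measurableSet_Ioc).2 (ae_of_all _ fun z hz => ?_)
    have hz0 := hz.1
    rw [Real.norm_of_nonneg (by positivity)]
    exact div_le_self (by positivity) (by linarith)
  · have hdom : IntegrableOn (fun z : ℝ => z ^ (-p - 1)) (Ioi 1) :=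
      integrableOn_Ioi_rpow_of_lt (by linarith) one_pos
    refine Integrable.mono' hdom (Measurable.aestronglyMeasurable (by fun_prop)) ?_
    refine (ae_restrict_iff' measurableSet_Ioi).2 (ae_of_all _ fun z hz => ?_)
    have hz0 : 0 < z := one_pos.trans hz
    rw [Real.norm_of_nonneg (by positivity), Real.rpow_sub_one hz0.ne']
    gcongr
    linarith

/-- The interference exponent is dropped and the noise factor `exp (-w)` is bounded by `w ^ (-(1 /
β))`. This power separates `z` from `u` and leaves `u ^ (-1 / 2)` and `z ^ (-(1 / β))`, both
integrable at `0`; the decay in `z` makes `1 / (1 + z)` integrable at infinity. -/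
lemma rho1_le {σ lam β z u : ℝ} (hσ : 0 < σ) (hlam : 0 < lam) (hβ : 2 < β) (hz : 0 < z)
    (hu : 0 < u) :
    rho1 σ lam β z u ≤ (σ ^ 2) ^ (-(1 / β)) * (1 / (Real.pi * lam)) ^ (-(1 / 2 : ℝ)) *
      (z ^ (-(1 / β)) * (Real.exp (-u) * u ^ ((1 / 2 : ℝ) - 1))) := by
  have hβ0 : 0 < β := by linarith
  have hJ := setIntegral_Ioi_one_div_nonneg (β := β) hz
  have hb : 1 / β ≤ 1 := by rw [div_le_one hβ0]; linarith
  set w := σ ^ 2 * z * (u / (Real.pi * lam)) ^ (β / 2) with hw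
  have hw0 : 0 < w := by positivity
  calc rho1 σ lam β z u ≤ Real.exp (-w) * Real.exp (-u) := by
        rw [rho1, ← Real.exp_add]
        refine Real.exp_le_exp.2 ?_
        have : 0 ≤ u * (2 * z ^ (2 / β) / β * ∫ v in Ioi (1 / z), v ^ (2 / β - 1) / (1 + v)) := by
          positivity
        rw [hw]
        linarith
    _ ≤ w ^ (-(1 / β)) * Real.exp (-u) := by
        gcongr
        exact exp_neg_le_rpow_neg (by positivity) hb hw0
    _ = _ := by
        rw [hw, Real.mul_rpow (by positivity) (by positivity), Real.mul_rpow (by positivity) hz.le,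
          ← Real.rpow_mul (by positivity), show β / 2 * -(1 / β) = -(1 / 2) by field_simp,
          show u / (Real.pi * lam) = u * (1 / (Real.pi * lam)) by ring,
          Real.mul_rpow hu.le (by positivity), show (1 / 2 : ℝ) - 1 = -(1 / 2) by norm_num]
        ring

lemma integrableOn_rho1_div {σ lam β : ℝ} (hσ : 0 < σ) (hlam : 0 < lam) (hβ : 2 < β) :
    IntegrableOn (fun p : ℝ × ℝ => rho1 σ lam β p.2 p.1 / (1 + p.2)) (Ioi 0 ×ˢ Ioi 0) := by
  have hβ0 : 0 < β := by linarith
  have h1 : IntegrableOn (fun u : ℝ => Real.exp (-u) * u ^ ((1 / 2 : ℝ) - 1)) (Ioi 0) :=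
    Real.GammaIntegral_convergent (by norm_num)
  have h2 : IntegrableOn (fun z : ℝ => z ^ (-(1 / β)) / (1 + z)) (Ioi 0) :=
    integrableOn_rpow_neg_div_one_add (by positivity) (by rw [div_lt_one hβ0]; linarith)
  have h3 := (Integrable.mul_prod h1 h2).const_mul
    ((σ ^ 2) ^ (-(1 / β)) * (1 / (Real.pi * lam)) ^ (-(1 / 2 : ℝ)))
  rw [Measure.prod_restrict] at h3
  have hm := measurable_rho1 σ lam β
  refine Integrable.mono' h3 (Measurable.aestronglyMeasurable (by fun_prop)) ?_
  refine (ae_restrict_iff' (measurableSet_Ioi.prod measurableSet_Ioi)).2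
    (ae_of_all _ fun p hp => ?_)
  have hu : 0 < p.1 := hp.1
  have hz : 0 < p.2 := hp.2
  have hr : 0 ≤ rho1 σ lam β p.2 p.1 := (Real.exp_pos _).le
  rw [Real.norm_of_nonneg (by positivity), div_le_iff₀ (by linarith)]
  refine (rho1_le hσ hlam hβ hz hu).trans_eq ?_
  field_simp

end Analysis

/-! ### Coverage probability and expected rate of the network. -/

section Network

variable {Ω : Type*} [MeasurableSpace Ω] {X : ℕ → Ω → Plane} {H : ℕ → ℕ → Ω → ℝ}

lemma measurable_nearestBS (hX : ∀ i, Measurable (X i)) (u : Plane) :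
    Measurable (nearestBS X u) := by
  have hN : ∀ i, Measurable fun ω => IsNearest X u ω i := fun i => by
    refine Measurable.forall fun j => measurableSet_setOfPred.1 ?_
    exact measurableSet_le ((hX i).sub_const u).norm ((hX j).sub_const u).norm
  refine measurable_to_countable' fun n => ?_
  -- As `sInf ∅ = 0`, the fibre over `0` also contains the outcomes without a nearest station.
  have hset : nearestBS X u ⁻¹' {n} = {ω | (IsNearest X u ω n ∧ ∀ k, k < n → ¬ IsNearest X u ω k) ∨
      (n = 0 ∧ ∀ k, ¬ IsNearest X u ω k)} := by
    ext ω
    change sInf {i | IsNearest X u ω i} = n ↔ _ ∨ _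
    constructor
    · rintro rfl
      by_cases hne : {i | IsNearest X u ω i}.Nonempty
      · exact Or.inl ⟨Nat.sInf_mem hne, fun k hk => Nat.notMem_of_lt_sInf hk⟩
      · rw [not_nonempty_iff_eq_empty] at hne
        refine Or.inr ⟨by rw [hne, Nat.sInf_empty], fun k hk => ?_⟩
        exact (hne ▸ (show k ∈ {i | IsNearest X u ω i} from hk) : k ∈ (∅ : Set ℕ))
    · rintro (⟨h1, h2⟩ | ⟨rfl, h⟩)
      · refine le_antisymm (Nat.sInf_le h1) ?_
        by_contra! hlt
        exact h2 _ hlt (Nat.sInf_mem (s := {i | IsNearest X u ω i}) ⟨n, h1⟩)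
      · rw [show {i | IsNearest X u ω i} = ∅ from eq_empty_of_forall_notMem h, Nat.sInf_empty]
  rw [hset]
  refine measurableSet_setOfPred.2 (Measurable.or ?_ ?_)
  · exact (hN n).and (Measurable.forall fun k => measurable_const.imp (hN k).not)
  · exact measurable_const.and (Measurable.forall fun k => (hN k).not)

lemma measurable_SINR (hX : ∀ i, Measurable (X i)) (hH : ∀ i t, Measurable (H i t)) (σ β : ℝ)
    (u : Plane) (i t : ℕ) : Measurable (SINR σ β X H u i t) := by
  have hP : ∀ j, Measurable (receivedPower β X H u j t) := fun j =>
    (hH j t).mul (((hX j).sub_const u).norm.pow_const (-β))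
  have hI : Measurable (interference β X H u i t) :=
    Measurable.tsum fun j => (hP j).ennreal_ofReal
  exact (hP i).ennreal_ofReal.div (measurable_const.add hI)

lemma measurable_SINR_nearestBS (hX : ∀ i, Measurable (X i)) (hH : ∀ i t, Measurable (H i t))
    (σ β : ℝ) (u : Plane) (t : ℕ) :
    Measurable fun ω => SINR σ β X H u (nearestBS X u ω) t ω :=
  (measurable_from_prod_countable_left (f := fun p : Ω × ℕ => SINR σ β X H u p.2 t p.1)
    fun i => measurable_SINR hX hH σ β u i t).comp
    (measurable_id.prodMk (measurable_nearestBS hX u))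

lemma scaledArea_lt_iff {lam : ℝ} (hlam : 0 < lam) {u x y : Plane} :
    scaledArea lam u x < scaledArea lam u y ↔ ‖x - u‖ < ‖y - u‖ := by
  have hpos : 0 < lam * Real.pi := by positivity
  rw [scaledArea, scaledArea, mul_lt_mul_iff_right₀ hpos,
    pow_lt_pow_iff_left₀ (norm_nonneg _) (norm_nonneg _) two_ne_zero]

lemma norm_pos_of_scaledArea_pos {lam : ℝ} {u x : Plane} (h : 0 < scaledArea lam u x) :
    0 < ‖x - u‖ := by
  rcases (norm_nonneg (x - u)).eq_or_lt with h0 | h0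
  · simp [scaledArea, ← h0] at h
  · exact h0

omit [MeasurableSpace Ω] in
lemma isNearest_iff_of_forall_lt {u : Plane} {ω : Ω} {i : ℕ}
    (h : ∀ j, j ≠ i → ‖X i ω - u‖ < ‖X j ω - u‖) (k : ℕ) : IsNearest X u ω k ↔ k = i := by
  constructor
  · intro hk
    by_contra hne
    exact absurd (hk i) (not_le.2 (h k hne))
  · rintro rfl j
    rcases eq_or_ne j k with rfl | hj
    · exact le_rfl
    · exact (h j hj).le

omit [MeasurableSpace Ω] in
lemma nearestBS_eq_of_forall_lt {u : Plane} {ω : Ω} {i : ℕ}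
    (h : ∀ j, j ≠ i → ‖X i ω - u‖ < ‖X j ω - u‖) : nearestBS X u ω = i := by
  rw [nearestBS, show {k | IsNearest X u ω k} = {i} from
    Set.ext fun k => isNearest_iff_of_forall_lt h k, csInf_singleton]

lemma norm_rpow_neg_mul {lam β : ℝ} (hlam : 0 < lam) {u x y : Plane} (hx : 0 < ‖x - u‖)
    (hy : 0 < ‖y - u‖) :
    ‖x - u‖ ^ β * ‖y - u‖ ^ (-β) = (scaledArea lam u x / scaledArea lam u y) ^ (β / 2) := by
  have hpos : 0 < lam * Real.pi := by positivity
  rw [scaledArea, scaledArea, mul_div_mul_left _ _ hpos.ne', ← div_pow, ← Real.rpow_natCast,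
    ← Real.rpow_mul (by positivity), Real.div_rpow hx.le hy.le, Real.rpow_neg hy.le]
  congr 3 <;> push_cast <;> ring_nf

lemma norm_rpow_eq {lam β : ℝ} (hlam : 0 < lam) {u x : Plane} :
    ‖x - u‖ ^ β = (scaledArea lam u x / (Real.pi * lam)) ^ (β / 2) := by
  have hpos : 0 < lam * Real.pi := by positivity
  rw [scaledArea, mul_comm Real.pi, mul_div_cancel_left₀ _ hpos.ne', ← Real.rpow_natCast,
    ← Real.rpow_mul (norm_nonneg _)]
  congr 1
  push_cast
  ring

-- Multiplying by the denominator and by `‖X b ω - u‖ ^ β` isolates the fading `H b t`, giving the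
-- form required by `measure_le_fading`. Positive noise keeps the quotient finite, so `toReal` loses
-- nothing.
omit [MeasurableSpace Ω] in
lemma le_toReal_SINR_iff {σ β z : ℝ} (hσ : 0 < σ) (hz : 0 ≤ z) {u : Plane} {b t : ℕ} {ω : Ω}
    (hpos : 0 < ‖X b ω - u‖) :
    z ≤ (SINR σ β X H u b t ω).toReal ↔
      ENNReal.ofReal (σ ^ 2 * z * ‖X b ω - u‖ ^ β) + ∑' j : {j // j ≠ b},
        ENNReal.ofReal (H j t ω * (z * (‖X b ω - u‖ ^ β * ‖X j ω - u‖ ^ (-β)))) ≤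
      ENNReal.ofReal (H b t ω) := by
  have hσ2 : ENNReal.ofReal (σ ^ 2) ≠ 0 := (ENNReal.ofReal_pos.2 (by positivity)).ne'
  have hden : ENNReal.ofReal (σ ^ 2) + interference β X H u b t ω ≠ 0 :=
    fun h => hσ2 (add_eq_zero.1 h).1
  have hd : 0 < ‖X b ω - u‖ ^ β := Real.rpow_pos_of_pos hpos β
  have htop : SINR σ β X H u b t ω ≠ ∞ := ENNReal.div_ne_top ENNReal.ofReal_ne_top hden
  rw [← ENNReal.ofReal_le_iff_le_toReal htop, SINR,
    ENNReal.le_div_iff_mul_le (Or.inl hden) (Or.inr ENNReal.ofReal_ne_top),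
    ← ENNReal.mul_le_mul_iff_right (ENNReal.ofReal_pos.2 hd).ne' ENNReal.ofReal_ne_top,
    ← mul_assoc, ← ENNReal.ofReal_mul hd.le, ← ENNReal.ofReal_mul hd.le, mul_add,
    ← ENNReal.ofReal_mul (by positivity), interference, ← ENNReal.tsum_mul_left]
  have h1 : ‖X b ω - u‖ ^ β * receivedPower β X H u b t ω = H b t ω := by
    rw [receivedPower, Real.rpow_neg hpos.le]
    field_simp
  have h2 : ∀ j : {j // j ≠ b}, ENNReal.ofReal (‖X b ω - u‖ ^ β * z) *
      ENNReal.ofReal (receivedPower β X H u j t ω) =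
      ENNReal.ofReal (H j t ω * (z * (‖X b ω - u‖ ^ β * ‖X j ω - u‖ ^ (-β)))) := by
    intro j
    rw [← ENNReal.ofReal_mul (by positivity), receivedPower]
    congr 1
    ring
  have h3 : ‖X b ω - u‖ ^ β * z * σ ^ 2 = σ ^ 2 * z * ‖X b ω - u‖ ^ β := by ring
  rw [h1, h3, tsum_congr h2]

variable {μ : Measure Ω} {lam : ℝ}

/-- The coverage probability given the positions of the base stations. -/
lemma IsCellularNetwork.measure_le_SINR_const [IsProbabilityMeasure μ]
    (hnet : IsCellularNetwork μ lam X H) (hlam : 0 < lam) {σ β z : ℝ} (hσ : 0 < σ)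
    (hz : 0 ≤ z) {u : Plane} {x : ℕ → Plane} (hx : ∀ i, 0 < ‖x i - u‖) (b t : ℕ) :
    μ {ω | z ≤ (SINR σ β (fun i _ => x i) H u b t ω).toReal} =
      expNeg (ENNReal.ofReal
          (σ ^ 2 * z * (scaledArea lam u (x b) / (Real.pi * lam)) ^ (β / 2)) +
        ∑' j : {j // j ≠ b}, ENNReal.ofReal (Real.log
          (1 + z * (scaledArea lam u (x b) / scaledArea lam u (x j)) ^ (β / 2)))) := by
  have hind : iIndepFun (fun j => H j t) μ :=
    hnet.fading_indep.precomp (g := fun j : ℕ => (j, t)) fun j k h => (Prod.mk.inj h).1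
  have hnn : ∀ j, 0 ≤ z * (‖x b - u‖ ^ β * ‖x j - u‖ ^ (-β)) := fun j => by positivity
  have := measure_le_fading (fun j => hnet.fading_law j t) (fun j => hnet.fading_measurable j t)
    hind hnn (ENNReal.ofReal (σ ^ 2 * z * ‖x b - u‖ ^ β)) b
  simp_rw [le_toReal_SINR_iff (X := fun i (_ : Ω) => x i) (H := H) (β := β) (t := t) hσ hz (hx b),
    this, norm_rpow_neg_mul hlam (hx b) (hx _), norm_rpow_eq (β := β) hlam (u := u) (x := x b)]

/-- Fubini's theorem for the positions of the base stations and the fading variables. -/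
lemma IsCellularNetwork.measure_le_SINR_nearestBS [IsProbabilityMeasure μ]
    (hnet : IsCellularNetwork μ lam X H) (σ β z : ℝ) (u : Plane) (t : ℕ) :
    μ {ω | z ≤ (SINR σ β X H u (nearestBS X u ω) t ω).toReal} =
      ∫⁻ ω, μ {ω' | z ≤ (SINR σ β (fun i _ => X i ω) H u (nearestBS X u ω) t ω').toReal} ∂μ := by
  -- Coordinates on the space of pairs (positions, fading), where the joint law is a product
  -- measure.
  set X' : ℕ → (ℕ → Plane) × (ℕ × ℕ → ℝ) → Plane := fun i p => p.1 i with hX'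
  set H' : ℕ → ℕ → (ℕ → Plane) × (ℕ × ℕ → ℝ) → ℝ := fun i t p => p.2 (i, t) with hH'
  have hXm : Measurable fun ω i => X i ω := measurable_pi_lambda _ hnet.ppp.measurable
  have hHm : Measurable fun ω (p : ℕ × ℕ) => H p.1 p.2 ω :=
    measurable_pi_lambda _ fun p => hnet.fading_measurable p.1 p.2
  have hS : MeasurableSet {p | z ≤ (SINR σ β X' H' u (nearestBS X' u p) t p).toReal} := by
    refine measurableSet_le measurable_const (Measurable.ennreal_toReal ?_)
    exact measurable_SINR_nearestBS (fun i => (measurable_pi_apply i).comp measurable_fst)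
      (fun i t => (measurable_pi_apply (i, t)).comp measurable_snd) σ β u t
  have h1 : μ {ω | z ≤ (SINR σ β X H u (nearestBS X u ω) t ω).toReal} =
      (μ.map fun ω => ((fun i => X i ω), fun p : ℕ × ℕ => H p.1 p.2 ω))
        {p | z ≤ (SINR σ β X' H' u (nearestBS X' u p) t p).toReal} := by
    rw [Measure.map_apply (hXm.prodMk hHm) hS]
    rfl
  have : IsProbabilityMeasure (μ.map fun ω (p : ℕ × ℕ) => H p.1 p.2 ω) :=
    Measure.isProbabilityMeasure_map hHm.aemeasurable
  rw [h1, (indepFun_iff_map_prod_eq_prod_map_map hXm.aemeasurable hHm.aemeasurable).1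
    hnet.fading_indep_ppp, Measure.prod_apply hS,
    lintegral_map (measurable_measure_prodMk_left hS) hXm]
  refine lintegral_congr fun ω => ?_
  rw [Measure.map_apply hHm (measurable_prodMk_left hS)]
  rfl

lemma IsHomogeneousPPP.ae_norm_pos [IsProbabilityMeasure μ] (hX : IsHomogeneousPPP μ lam X)
    (hlam : 0 < lam) (u : Plane) : ∀ᵐ ω ∂μ, ∀ i, 0 < ‖X i ω - u‖ := by
  filter_upwards [(hX.isPoissonPP_scaledArea hlam u).ae_pos] with ω hω i
  exact norm_pos_of_scaledArea_pos (hω i)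

lemma IsHomogeneousPPP.ae_forall_norm_lt [IsProbabilityMeasure μ] (hX : IsHomogeneousPPP μ lam X)
    (hlam : 0 < lam) (u : Plane) :
    ∀ᵐ ω ∂μ, ∃ i, ∀ j, j ≠ i → ‖X i ω - u‖ < ‖X j ω - u‖ := by
  filter_upwards [(hX.isPoissonPP_scaledArea hlam u).ae_exists_lt] with ω hω
  obtain ⟨i, hi⟩ := hω
  exact ⟨i, fun j hj => (scaledArea_lt_iff hlam).1 (hi j hj)⟩

/-- The coverage probability of a user that is served by its nearest base station. -/
theorem IsCellularNetwork.measure_le_SINR_eq_lintegral_rho1 [IsProbabilityMeasure μ]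
    (hnet : IsCellularNetwork μ lam X H) (hlam : 0 < lam) {σ β z : ℝ} (hσ : 0 < σ) (hβ : 2 < β)
    (hz : 0 < z) (u : Plane) (t : ℕ) :
    μ {ω | z ≤ (SINR σ β X H u (nearestBS X u ω) t ω).toReal} =
      ∫⁻ v in Ioi 0, ENNReal.ofReal (rho1 σ lam β z v) := by
  have hβ0 : 0 < β / 2 := by linarith
  have hP := hnet.ppp.isPoissonPP_scaledArea hlam u
  set m : Ω → ℝ := fun ω => scaledArea lam u (X (nearestBS X u ω) ω) with hm
  have hmm : Measurable m := (measurable_scaledArea lam u).comp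
    ((measurable_from_prod_countable_left (f := fun p : Ω × ℕ => X p.2 p.1)
      hnet.ppp.measurable).comp (measurable_id.prodMk (measurable_nearestBS hnet.ppp.measurable u)))
  have hbest : ∀ᵐ ω ∂μ, ∀ j, j ≠ nearestBS X u ω → m ω < scaledArea lam u (X j ω) := by
    filter_upwards [hnet.ppp.ae_forall_norm_lt hlam u] with ω ⟨i, hi⟩ j hj
    have hb := nearestBS_eq_of_forall_lt hi
    rw [← hb] at hi
    exact (scaledArea_lt_iff hlam).2 (hi j hj)
  have hleast : ∀ᵐ ω ∂μ, IsLeast (range fun i => scaledArea lam u (X i ω)) (m ω) := by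
    filter_upwards [hbest] with ω hω
    refine ⟨⟨nearestBS X u ω, rfl⟩, ?_⟩
    rintro _ ⟨j, rfl⟩
    rcases eq_or_ne j (nearestBS X u ω) with hj | hj
    · exact (congrArg (fun k => scaledArea lam u (X k ω)) hj).ge
    · exact (hω j hj).le
  -- `c` is the noise exponent and `φ` the exponent due to one interferer, as functions of the
  -- scaled area `r` of the serving station.
  set c : ℝ → ℝ≥0∞ := fun r => ENNReal.ofReal (σ ^ 2 * z * (r / (Real.pi * lam)) ^ (β / 2))
    with hc
  set φ : ℝ → ℝ → ℝ≥0∞ := fun r s => ENNReal.ofReal (Real.log (1 + z * (r / s) ^ (β / 2)))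
    with hφ
  have hccont : Continuous c := by
    refine ENNReal.continuous_ofReal.comp (continuous_const.mul ?_)
    exact (continuous_id.div_const _).rpow_const fun _ => Or.inr hβ0.le
  have hφm : Measurable (Function.uncurry φ) := by
    simp only [hφ, Function.uncurry_def]
    fun_prop
  have hmono : ∀ s, 0 < s → MonotoneOn (fun r => φ r s) (Ici 0) := by
    intro s hs r hr r' hr' hrr'
    have hr0 : 0 ≤ r := hr
    refine ENNReal.ofReal_le_ofReal (Real.log_le_log (by positivity) ?_)
    gcongr
  have hcont : ∀ s, 0 < s → ContinuousOn (fun r => φ r s) (Ici 0) := by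
    intro s hs
    refine ENNReal.continuous_ofReal.comp_continuousOn (ContinuousOn.log ?_ fun r hr => ?_)
    · refine (continuous_const.add (continuous_const.mul ?_)).continuousOn
      exact (continuous_id.div_const _).rpow_const fun _ => Or.inr hβ0.le
    · have hr0 : 0 ≤ r := hr
      positivity
  have hcond : ∀ᵐ ω ∂μ,
      μ {ω' | z ≤ (SINR σ β (fun i _ => X i ω) H u (nearestBS X u ω) t ω').toReal} =
        expNeg (c (m ω) + ∑' i, (Ioi (m ω)).indicator (φ (m ω)) (scaledArea lam u (X i ω))) := by
    filter_upwards [hbest, hnet.ppp.ae_norm_pos hlam u] with ω hω hpos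
    rw [hnet.measure_le_SINR_const hlam hσ hz.le hpos]
    congr 2
    -- Almost surely the interferers are exactly the stations whose scaled area exceeds `m ω`, so
    -- excluding an index is the same as restricting to `Ioi (m ω)`.
    refine (tsum_subtype {j | j ≠ nearestBS X u ω}
      fun j => φ (m ω) (scaledArea lam u (X j ω))).trans (tsum_congr fun j => ?_)
    by_cases hj : j = nearestBS X u ω
    · rw [indicator_of_notMem (by simpa using hj), indicator_of_notMem]
      simp [hm, hj]
    · rw [indicator_of_mem (by exact hj), indicator_of_mem (mem_Ioi.2 (hω j hj))]
  rw [hnet.measure_le_SINR_nearestBS, lintegral_congr_ae hcond,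
    hP.lintegral_first hmm hleast hccont.measurable hccont.continuousOn hφm hmono hcont]
  exact setLIntegral_congr_fun measurableSet_Ioi fun v hv => ofReal_rho1 hlam hβ hz hv

lemma intervalIntegral_one_div_one_add {y : ℝ} (hy : 0 ≤ y) :
    ∫ z in (0 : ℝ)..y, 1 / (1 + z) = Real.log (1 + y) := by
  have h := intervalIntegral.integral_comp_add_left (a := 0) (b := y) (fun z : ℝ => 1 / z) 1
  rw [h, integral_one_div_of_pos (by norm_num) (by linarith)]
  simp

/-- The expected data rate of a user that is served by its nearest base station. -/
theorem IsCellularNetwork.lintegral_dataRate [IsProbabilityMeasure μ]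
    (hnet : IsCellularNetwork μ lam X H) (hlam : 0 < lam) {σ β : ℝ} (hσ : 0 < σ) (hβ : 2 < β)
    (u : Plane) (t : ℕ) :
    ∫⁻ ω, ENNReal.ofReal (dataRate σ β X H u (nearestBS X u ω) t ω) ∂μ =
      ENNReal.ofReal (tau1 σ lam β) := by
  have hSm : Measurable fun ω => (SINR σ β X H u (nearestBS X u ω) t ω).toReal :=
    (measurable_SINR_nearestBS hnet.ppp.measurable hnet.fading_measurable σ β u t).ennreal_toReal
  have hint := integrableOn_rho1_div hσ hlam hβ
  have hcont : ∀ z > (0 : ℝ), IntervalIntegrable (fun z : ℝ => 1 / (1 + z)) volume 0 z := by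
    intro z hz
    refine ContinuousOn.intervalIntegrable (continuousOn_const.div (by fun_prop) fun v hv => ?_)
    rw [uIcc_of_le hz.le] at hv
    linarith [hv.1]
  have hnn : ∀ᵐ z ∂volume.restrict (Ioi (0 : ℝ)), 0 ≤ 1 / (1 + z) :=
    (ae_restrict_iff' measurableSet_Ioi).2 (ae_of_all _ fun z hz => by
      have hz0 : 0 < z := hz
      positivity)
  -- Layer cake formula: `E log (1 + S) = ∫ P(S ≥ z) / (1 + z) dz`.
  have hlc := lintegral_comp_eq_lintegral_meas_le_mul (g := fun z : ℝ => 1 / (1 + z)) μ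
    (ae_of_all _ fun ω => ENNReal.toReal_nonneg) hSm.aemeasurable hcont hnn
  simp_rw [intervalIntegral_one_div_one_add ENNReal.toReal_nonneg] at hlc
  have hm := measurable_rho1 σ lam β
  have hnn' : 0 ≤ᵐ[volume.restrict (Ioi 0 ×ˢ Ioi 0)]
      fun p : ℝ × ℝ => rho1 σ lam β p.2 p.1 / (1 + p.2) := by
    refine (ae_restrict_iff' (measurableSet_Ioi.prod measurableSet_Ioi)).2
      (ae_of_all _ fun p hp => ?_)
    have hz : 0 < p.2 := hp.2
    exact div_nonneg (Real.exp_pos _).le (by linarith)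
  have htau : tau1 σ lam β =
      ∫ p in Ioi (0 : ℝ) ×ˢ Ioi (0 : ℝ), rho1 σ lam β p.2 p.1 / (1 + p.2) := by
    rw [tau1, Measure.volume_eq_prod]
    rw [Measure.volume_eq_prod] at hint
    exact (setIntegral_prod _ hint).symm
  rw [htau, ofReal_integral_eq_lintegral_ofReal hint hnn', Measure.volume_eq_prod,
    ← Measure.prod_restrict, lintegral_prod_symm' _ (by fun_prop)]
  refine hlc.trans (setLIntegral_congr_fun measurableSet_Ioi fun z hz => ?_)
  have hz0 : 0 < z := hz
  simp only
  rw [hnet.measure_le_SINR_eq_lintegral_rho1 hlam hσ hβ hz0, ← lintegral_mul_const']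
  · refine lintegral_congr fun v => ?_
    rw [← ENNReal.ofReal_mul (show 0 ≤ rho1 σ lam β z v from (Real.exp_pos _).le), mul_one_div]
  · exact ENNReal.ofReal_ne_top

end Network

end HandoverSkipping

end

/-! ### Summation over the movement period. -/

theorem theorem1 {Ω : Type*} [MeasurableSpace Ω] (μ : Measure Ω) [IsProbabilityMeasure μ]
    (σ lam β : ℝ) (hσ : 0 < σ) (hlam : 0 < lam) (hβ : 2 < β)
    (X : ℕ → Ω → HandoverSkipping.Plane) (H : ℕ → ℕ → Ω → ℝ)
    (hnet : HandoverSkipping.IsCellularNetwork μ lam X H)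
    (s : ℕ) (hs : 0 < s) (l : ℝ) (hl : 0 ≤ l) :
    -- at each time there is almost surely exactly one nearest base station
    (∀ t < s, ∀ᵐ ω ∂μ, ∃! i, HandoverSkipping.IsNearest X (HandoverSkipping.position s l t) ω i) ∧
    -- the data rates have finite expectation
    (∀ t < s, Integrable (HandoverSkipping.nonSkippingRate σ β X H s l t) μ) ∧
    -- the double integral converges
    IntegrableOn (fun p : ℝ × ℝ => HandoverSkipping.rho1 σ lam β p.2 p.1 / (1 + p.2))
      (Ioi 0 ×ˢ Ioi 0) ∧
    HandoverSkipping.D1 μ σ β X H s l = s * HandoverSkipping.tau1 σ lam β := by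
  have hm : ∀ t, Measurable (HandoverSkipping.nonSkippingRate σ β X H s l t) := fun t =>
    Real.measurable_log.comp (measurable_const.add (HandoverSkipping.measurable_SINR_nearestBS
      hnet.ppp.measurable hnet.fading_measurable σ β _ t).ennreal_toReal)
  have hnn : ∀ t ω, 0 ≤ HandoverSkipping.nonSkippingRate σ β X H s l t ω := fun t ω =>
    Real.log_nonneg (le_add_of_nonneg_right ENNReal.toReal_nonneg)
  -- The value is the same at every position, which is why neither `t` nor `l` appears on the right.
  have hlint : ∀ t, ∫⁻ ω, ENNReal.ofReal (HandoverSkipping.nonSkippingRate σ β X H s l t ω) ∂μ =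
      ENNReal.ofReal (HandoverSkipping.tau1 σ lam β) := fun t =>
    hnet.lintegral_dataRate hlam hσ hβ (HandoverSkipping.position s l t) t
  have hint : ∀ t, Integrable (HandoverSkipping.nonSkippingRate σ β X H s l t) μ := fun t => by
    refine ⟨(hm t).aestronglyMeasurable, ?_⟩
    rw [hasFiniteIntegral_iff_ofReal (ae_of_all _ (hnn t)), hlint]
    exact ENNReal.ofReal_lt_top
  refine ⟨fun t _ => ?_, fun t _ => hint t, HandoverSkipping.integrableOn_rho1_div hσ hlam hβ, ?_⟩
  · filter_upwards [hnet.ppp.ae_forall_norm_lt hlam (HandoverSkipping.position s l t)]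
      with ω ⟨i, hi⟩
    exact ⟨i, (HandoverSkipping.isNearest_iff_of_forall_lt hi i).2 rfl,
      fun k hk => (HandoverSkipping.isNearest_iff_of_forall_lt hi k).1 hk⟩
  · have htau : 0 ≤ HandoverSkipping.tau1 σ lam β :=
      setIntegral_nonneg measurableSet_Ioi fun u _ => setIntegral_nonneg measurableSet_Ioi
        fun z hz => div_nonneg (Real.exp_pos _).le (by linarith [mem_Ioi.1 hz])
    rw [HandoverSkipping.D1, integral_finsetSum _ fun t _ => hint t]
    have hval : ∀ t, ∫ ω, HandoverSkipping.nonSkippingRate σ β X H s l t ω ∂μ =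
        HandoverSkipping.tau1 σ lam β := fun t => by
      rw [integral_eq_lintegral_of_nonneg_ae (ae_of_all _ (hnn t)) (hm t).aestronglyMeasurable,
        hlint, ENNReal.toReal_ofReal htau]
    simp [hval]
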